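/- Let $d,q\ge 1$ be integers. A $d$-array of size $(n_1,\dots,n_d)$ over the alphabet $\{1,\dots,q\}$ is a family of symbols $a_{\mathbf i}\in\{1,\dots,q\}$ indexed by $\mathbf i\in[n_1]\times\cdots\times[n_d]$, where $[n]=\{1,\dots,n\}$; it has order $n$ if $n_1=\cdots=n_d=n$. A coordinate restriction of such an array chooses some $j\in[d]$ and $\ell\in[n_j]$ and deletes all symbols whose $j$-th coordinate is $\ell$, which gives a $d$-array of size $(n_1,\dots,n_{j-1},n_j-1,n_{j+1},\dots,n_d)$. A $d$-array contains another one if the latter can be obtained from it by a finite (possibly empty) sequence of coordinate restrictions. A $d$-array is $k$-universal if it contains every $d$-array over the same alphabet of size $(n_1,\dots,n_d)$ with $n_j\le k$ for all $j\in[d]$. Let $f_d(q,k)$ be the minimum $n$ such that there is a $k$-universal $d$-array of order $n$ over $\{1,\dots,q\}$. Let $d,q\ge 2$ be fixed integers. Then the minimum $f_d(q,k)$ exists for every $k\ge 1$, and, as $k\to\infty$, $$f_d(q,k)=(1+o(1))\,\frac{k}{e}\,q^{k^{d-1}/d}.$$ -/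

import Mathlib

open Filter

/-- A `d`-dimensional array of size `n = (n₁, …, n_d)` over the `q`-symbol alphabet: a symbol for
every index vector in `[n₁] × ⋯ × [n_d]` (indices are numbered from `0`). -/
def DArray (q : ℕ) {d : ℕ} (n : Fin d → ℕ) : Type :=
  ((j : Fin d) → Fin (n j)) → Fin q

namespace DArray

/-- Coordinate restriction: delete all symbols whose `j`-th coordinate is `l`. The `j`-th side
length drops by one, and old `j`-th coordinates larger than `l` are renumbered, so that the new
coordinate `x` comes from the old coordinate `x` if `x < l`, and from `x + 1` if `l ≤ x`. -/
def restrict {q d : ℕ} {n : Fin d → ℕ} (A : DArray q n) (j : Fin d) (l : Fin (n j)) :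
    DArray q (Function.update n j (n j - 1)) :=
  fun i => A fun t =>
    ⟨if t = j ∧ (l : ℕ) ≤ (i t : ℕ) then (i t : ℕ) + 1 else (i t : ℕ), by
      have h := (i t).isLt
      by_cases ht : t = j
      · subst ht
        have h2 : ((i t : ℕ)) < n t - 1 := by simpa using h
        split_ifs <;> omega
      · simpa [ht, Function.update_of_ne ht] using h⟩

/-- `A.Contains B`: the array `B` can be obtained from `A` by finitely many (possibly zero)
successive coordinate restrictions. -/
inductive Contains {q d : ℕ} :
    {n m : Fin d → ℕ} → DArray q n → DArray q m → Prop
  | refl {n : Fin d → ℕ} (A : DArray q n) : Contains A A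
  | step {n m : Fin d → ℕ} (A : DArray q n) (B : DArray q m) (j : Fin d) (l : Fin (n j)) :
      Contains (A.restrict j l) B → Contains A B

/-- `A` is `k`-universal: it contains every array over the same alphabet all of whose side
lengths are at most `k`. -/
def IsUniversal {q d : ℕ} {n : Fin d → ℕ} (k : ℕ) (A : DArray q n) : Prop :=
  ∀ (m : Fin d → ℕ), (∀ j, m j ≤ k) → ∀ B : DArray q m, A.Contains B

/-- The set of all `n` for which some `d`-array of order `n` (size `(n, …, n)`) over the
`q`-symbol alphabet is `k`-universal. -/
def universalOrders (d q k : ℕ) : Set ℕ :=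
  {n | ∃ A : DArray q (fun _ : Fin d => n), A.IsUniversal k}

/-- `f_d(q, k)`: the least order of a `k`-universal `d`-array over the `q`-symbol alphabet. -/
noncomputable def minUniversalOrder (d q k : ℕ) : ℕ :=
  sInf (universalOrders d q k)

end DArray

/-! Lower bound by counting: the `n.choose k ^ d` subarrays of order `k` must include all `q ^ k ^
d` arrays, and `n.choose k ≤ (e n / k) ^ k`. This gives `n ≥ T = (k / e) q ^ (k ^ (d-1) / d)` for
every `k ≥ 1`, with no error term (`asymptoticOrder_le_of_mem`).

Upper bound by a uniformly random array of order `n ≥ a T + k`, with `a > 1` fixed. Fix a target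
`B`, let `μ` be the expected number of its copies and `Δ` the sum of `q ^ (-|union|)` over ordered
pairs of copies that share a cell. The extended Janson inequality (`bernExp_noneSet_le_exp_neg_sq`)
bounds the probability of having no copy by `exp (-μ² / (2Δ))`. It needs independent bits, whereas
the letters of one cell exclude each other; `card_avoid_le` shows that replacing each letter by
independent bits can only raise the probability of avoidance.

Two copies whose coordinate sets meet in `s_1, …, s_d` elements share at most `∏ s_t` cells. By
AM-GM `∏ s_t ≤ ∑ s_t ^ d / d`, so the sum over pairs factors over coordinates and `Δ ≤ μ² G ^ d`,
where `G` is the one-dimensional `overlapSum`. Treating overlaps below and above `k / 2` separately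
shows that `G` is exponentially small in `k`; large overlaps are where `a > 1` is needed. Hence `2 k
^ d (log q) G ^ d < 1` for large `k`, and a union bound over the `q ^ k ^ d` targets leaves a
universal array. -/

namespace DArray

/-! ### Containment as increasing coordinate maps, and the counting bound -/

/-- The coordinate map underlying `DArray.restrict`. -/
def skip {d : ℕ} {n : Fin d → ℕ} (j : Fin d) (l : Fin (n j)) (t : Fin d)
    (x : Fin (Function.update n j (n j - 1) t)) : Fin (n t) :=
  ⟨if t = j ∧ (l : ℕ) ≤ (x : ℕ) then (x : ℕ) + 1 else (x : ℕ), by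
    have h := x.isLt
    by_cases ht : t = j
    · subst ht
      have h2 : (x : ℕ) < n t - 1 := by simpa using h
      split_ifs <;> omega
    · simpa [ht, Function.update_of_ne ht] using h⟩

theorem restrict_apply {q d : ℕ} {n : Fin d → ℕ} (A : DArray q n) (j : Fin d) (l : Fin (n j))
    (i) : A.restrict j l i = A fun t => skip j l t (i t) := rfl

theorem skip_strictMono {d : ℕ} {n : Fin d → ℕ} (j : Fin d) (l : Fin (n j)) (t : Fin d) :
    StrictMono (skip j l t) := by
  intro x y hxy
  have hxy' : (x : ℕ) < y := hxy
  simp only [skip, Fin.mk_lt_mk]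
  split_ifs <;> omega

theorem Contains.exists_strictMono {q d : ℕ} {n m : Fin d → ℕ} {A : DArray q n} {B : DArray q m}
    (h : A.Contains B) : ∃ φ : ∀ j, Fin (m j) → Fin (n j), (∀ j, StrictMono (φ j)) ∧
      ∀ i, B i = A fun t => φ t (i t) := by
  induction h with
  | refl A => exact ⟨fun j => id, fun j => strictMono_id, fun i => rfl⟩
  | step A B j l _ ih =>
    obtain ⟨φ, hφ, hB⟩ := ih
    exact ⟨fun t x => skip j l t (φ t x), fun t => (skip_strictMono j l t).comp (hφ t),
      fun i => by rw [hB, restrict_apply]⟩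

/-- Induction on the total side length: if the sizes differ, some `φ j` misses an index `l`, and
deleting `l` and renumbering leaves a smaller instance. -/
theorem contains_of_strictMono {q d : ℕ} {m : Fin d → ℕ} (B : DArray q m) (N : ℕ) :
    ∀ {n : Fin d → ℕ} (A : DArray q n) (φ : ∀ j, Fin (m j) → Fin (n j)),
      ∑ j, n j = N → (∀ j, StrictMono (φ j)) → (∀ i, B i = A fun t => φ t (i t)) →
      A.Contains B := by
  induction N with
  | zero =>
    intro n A φ hN hφ hB
    have hn : ∀ j, n j = 0 := fun j => by
      have := Finset.sum_eq_zero_iff.1 hN j (Finset.mem_univ j); exact this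
    have hm : m = n := by
      funext j
      have := Fintype.card_le_of_injective _ (hφ j).injective
      simp only [Fintype.card_fin] at this
      have := hn j; omega
    subst hm
    have : B = A := by
      funext i
      rw [hB]; congr 1; funext t
      exact absurd (i t).isLt (by have := hn t; omega)
    subst this
    exact Contains.refl _
  | succ N ih =>
    intro n A φ hN hφ hB
    by_cases hmn : ∀ j, m j = n j
    · obtain rfl : m = n := funext hmn
      have : B = A := by
        funext i
        rw [hB]; congr 1; funext t
        -- A strictly increasing map is determined by its range, so here `φ t` is the identity.
        have hs : Function.Surjective (φ t) := Finite.injective_iff_surjective.1 (hφ t).injective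
        have := ((hφ t).range_inj strictMono_id).1 (by rw [hs.range_eq, Set.range_id])
        exact congrFun this (i t)
      subst this
      exact Contains.refl _
    · push Not at hmn
      obtain ⟨j, hj⟩ := hmn
      have hlt : m j < n j := lt_of_le_of_ne
        (by simpa using Fintype.card_le_of_injective _ (hφ j).injective) hj
      have hns : ¬ Function.Surjective (φ j) := fun hs => by
        have := Fintype.card_le_of_surjective _ hs
        simp only [Fintype.card_fin] at this; omega
      simp only [Function.Surjective, not_forall, not_exists] at hns
      obtain ⟨l, hl⟩ := hns
      have hval : ∀ x, (φ j x : ℕ) ≠ l := fun x h => hl x (Fin.ext h)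
      let ψ : ∀ t, Fin (m t) → Fin (Function.update n j (n j - 1) t) := fun t x =>
        ⟨if t = j ∧ (l : ℕ) < (φ t x : ℕ) then (φ t x : ℕ) - 1 else (φ t x : ℕ), by
          by_cases ht : t = j
          · subst ht
            have h1 := (φ t x).isLt
            have h2 := l.isLt
            have h3 := hval x
            simp only [Function.update_self, true_and]
            split_ifs <;> omega
          · simp [ht]⟩
      have hskip : ∀ t x, skip j l t (ψ t x) = φ t x := by
        intro t x
        apply Fin.ext
        by_cases ht : t = j
        · subst ht
          have h3 := hval x
          simp only [skip, ψ, true_and]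
          split_ifs <;> omega
        · simp [skip, ψ, ht]
      have hψ : ∀ t, StrictMono (ψ t) := fun t x y hxy =>
        (skip_strictMono j l t).lt_iff_lt.1 (by rw [hskip, hskip]; exact hφ t hxy)
      refine Contains.step A B j l (ih (A.restrict j l) ψ ?_ hψ ?_)
      · have h1 := Finset.sum_update_of_mem (Finset.mem_univ j) n (n j - 1)
        have h2 := Finset.add_sum_erase Finset.univ n (Finset.mem_univ j)
        rw [h1, ← Finset.erase_eq]
        omega
      · intro i
        rw [hB, restrict_apply]
        simp only [hskip]

theorem contains_iff {q d : ℕ} {n m : Fin d → ℕ} {A : DArray q n} {B : DArray q m} :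
    A.Contains B ↔ ∃ φ : ∀ j, Fin (m j) → Fin (n j), (∀ j, StrictMono (φ j)) ∧
      ∀ i, B i = A fun t => φ t (i t) :=
  ⟨Contains.exists_strictMono, fun ⟨φ, hφ, hB⟩ => contains_of_strictMono B _ A φ rfl hφ hB⟩

/-- It suffices to contain the arrays all of whose side lengths are exactly `k`. -/
theorem isUniversal_of_forall_order {q d : ℕ} (hq : 0 < q) {n : Fin d → ℕ} {k : ℕ}
    {A : DArray q n} (h : ∀ B : DArray q (fun _ : Fin d => k), A.Contains B) :
    A.IsUniversal k := by
  intro m hm B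
  -- `B` is padded to order `k` with the letter `0`; its copy sits on the initial indices.
  obtain ⟨φ, hφ, hB⟩ := contains_iff.1
    (h fun i => if hi : ∀ j, (i j : ℕ) < m j then B fun j => ⟨i j, hi j⟩ else ⟨0, hq⟩)
  refine contains_iff.2 ⟨fun j x => φ j (Fin.castLE (hm j) x), fun j => (hφ j).comp
    (Fin.strictMono_castLE _), fun i => ?_⟩
  rw [← hB fun t => Fin.castLE (hm t) (i t)]
  simp

theorem universalOrders_anti (d q : ℕ) {k l : ℕ} (h : k ≤ l) :
    universalOrders d q l ⊆ universalOrders d q k :=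
  fun _ ⟨A, hA⟩ => ⟨A, fun m hm B => hA m (fun j => (hm j).trans h) B⟩

/-- A `k`-universal array of order `n` has at least as many subarrays of order `k` as there are
arrays of order `k`. -/
theorem IsUniversal.pow_le_choose_pow {q d n k : ℕ} {A : DArray q (fun _ : Fin d => n)}
    (hA : A.IsUniversal k) : q ^ k ^ d ≤ n.choose k ^ d := by
  classical
  let K := {s : Finset (Fin n) // s.card = k}
  have hK : Fintype.card K = n.choose k := by simp [K]
  let F : (Fin d → K) → ((Fin d → Fin k) → Fin q) := fun I i =>
    A fun t => (I t).1.orderEmbOfFin (I t).2 (i t)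
  have hF : Function.Surjective F := by
    intro B
    obtain ⟨φ, hφ, hB⟩ := contains_iff.1 (hA (fun _ => k) (fun _ => le_rfl) B)
    -- `φ t` is the unique increasing enumeration of its image.
    refine ⟨fun t => ⟨Finset.univ.image (φ t), ?_⟩, ?_⟩
    · rw [Finset.card_image_of_injective _ (hφ t).injective]; simp
    · funext i
      rw [hB i]
      simp only [F]
      congr 1
      funext t
      rw [← Finset.orderEmbOfFin_unique _ (fun x => Finset.mem_image_of_mem _ (Finset.mem_univ x))
        (hφ t)]
  have := Fintype.card_le_of_surjective F hF
  simpa [hK] using this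

end DArray

/-! ### Expectations under product weights -/

section ProductExpectation

variable {C γ : Type*} [Fintype C] [DecidableEq C] [Fintype γ]

/-- Expectation of `F` under the product of the weights `u c`. -/
noncomputable def prodExp (u : C → γ → ℝ) (F : (C → γ) → ℝ) : ℝ :=
  ∑ y, (∏ c, u c (y c)) * F y

theorem prodExp_prod (u h : C → γ → ℝ) :
    prodExp u (fun y => ∏ c, h c (y c)) = ∏ c, ∑ g, u c g * h c g := by
  simp only [prodExp, ← Finset.prod_mul_distrib]
  rw [Finset.prod_univ_sum, Fintype.piFinset_univ]

theorem prodExp_one {u : C → γ → ℝ} (hu : ∀ c, ∑ g, u c g = 1) :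
    prodExp u (fun _ => 1) = 1 := by
  have := prodExp_prod u (fun _ _ => 1)
  simpa [hu] using this

theorem prodExp_mono {u : C → γ → ℝ} (hu : ∀ c g, 0 ≤ u c g) {F G : (C → γ) → ℝ}
    (h : ∀ y, F y ≤ G y) : prodExp u F ≤ prodExp u G :=
  Finset.sum_le_sum fun y _ => mul_le_mul_of_nonneg_left (h y)
    (Finset.prod_nonneg fun c _ => hu c (y c))

theorem prodExp_const_mul (u : C → γ → ℝ) (a : ℝ) (F : (C → γ) → ℝ) :
    prodExp u (fun y => a * F y) = a * prodExp u F := by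
  simp only [prodExp, Finset.mul_sum]
  exact Finset.sum_congr rfl fun y _ => by ring

theorem prodExp_sub (u : C → γ → ℝ) (F G : (C → γ) → ℝ) :
    prodExp u (fun y => F y - G y) = prodExp u F - prodExp u G := by
  simp only [prodExp, mul_sub, Finset.sum_sub_distrib]

theorem prodExp_sum {ι : Type*} (u : C → γ → ℝ) (T : Finset ι) (F : ι → (C → γ) → ℝ) :
    prodExp u (fun y => ∑ i ∈ T, F i y) = ∑ i ∈ T, prodExp u (F i) := by
  simp only [prodExp, Finset.mul_sum]
  exact Finset.sum_comm

/-- An expectation can be computed by first averaging over the coordinate `c`. -/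
theorem prodExp_split (u : C → γ → ℝ) (F : (C → γ) → ℝ) (c : C) :
    prodExp u F = ∑ z : {j // j ≠ c} → γ, (∏ j : {j // j ≠ c}, u j (z j)) *
      ∑ g, u c g * F ((Equiv.funSplitAt c γ).symm (g, z)) := by
  simp only [Finset.mul_sum]
  rw [prodExp, ← (Equiv.funSplitAt c γ).symm.sum_comp, Fintype.sum_prod_type, Finset.sum_comm]
  refine Finset.sum_congr rfl fun z _ => Finset.sum_congr rfl fun g _ => ?_
  rw [← mul_assoc]
  congr 1
  rw [← Finset.mul_prod_erase _ _ (Finset.mem_univ c), mul_comm]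
  congr 1
  · rw [Finset.prod_subtype (p := fun j => j ≠ c) (Finset.univ.erase c) (by simp)
      (fun j => u j ((Equiv.funSplitAt c γ).symm (g, z) j))]
    refine Finset.prod_congr rfl fun j _ => ?_
    simp [Equiv.funSplitAt, Equiv.piSplitAt, j.2]
  · simp [Equiv.funSplitAt, Equiv.piSplitAt]

/-- Fubini: with all coordinates but `c` fixed, both fibres carry the same weight, so comparing the
averages over `c` suffices. -/
theorem prodExp_le_of_coord {u u' : C → γ → ℝ} (hu : ∀ c g, 0 ≤ u c g) {F F' : (C → γ) → ℝ}
    (c : C) (huu : ∀ j, j ≠ c → u j = u' j)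
    (h : ∀ y, ∑ g, u c g * F (Function.update y c g) ≤
      ∑ g, u' c g * F' (Function.update y c g)) : prodExp u F ≤ prodExp u' F' := by
  rw [prodExp_split u F c, prodExp_split u' F' c]
  refine Finset.sum_le_sum fun z _ => ?_
  have h1 : ∏ j : {j // j ≠ c}, u j (z j) = ∏ j : {j // j ≠ c}, u' j (z j) :=
    Finset.prod_congr rfl fun j _ => by rw [huu j j.2]
  rw [← h1]
  refine mul_le_mul_of_nonneg_left ?_ (Finset.prod_nonneg fun j _ => hu _ _)
  rcases isEmpty_or_nonempty γ with hγ | ⟨⟨g₀⟩⟩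
  · rw [Fintype.sum_empty, Fintype.sum_empty]
  have h2 : ∀ g, (Equiv.funSplitAt c γ).symm (g, z) =
      Function.update ((Equiv.funSplitAt c γ).symm (g₀, z)) c g := by
    intro g
    funext j
    by_cases hj : j = c
    · subst hj; simp [Equiv.funSplitAt, Equiv.piSplitAt]
    · simp [Equiv.funSplitAt, Equiv.piSplitAt, hj]
  have h3 : ∀ G : (C → γ) → ℝ, ∀ g, G ((Equiv.funSplitAt c γ).symm (g, z)) =
      G (Function.update ((Equiv.funSplitAt c γ).symm (g₀, z)) c g) :=
    fun G g => congrArg G (h2 g)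
  simp only [h3 F, h3 F']
  exact h _

theorem prodExp_congr_coord {u : C → γ → ℝ} (hu : ∀ c g, 0 ≤ u c g) {F F' : (C → γ) → ℝ}
    (c : C) (h : ∀ y, ∑ g, u c g * F (Function.update y c g) =
      ∑ g, u c g * F' (Function.update y c g)) : prodExp u F = prodExp u F' :=
  le_antisymm (prodExp_le_of_coord hu c (fun _ _ => rfl) fun y => (h y).le)
    (prodExp_le_of_coord hu c (fun _ _ => rfl) fun y => (h y).ge)

/-- Weights may be replaced coordinate by coordinate. -/
theorem prodExp_le_of_forall_coord {u u' : C → γ → ℝ} (hu : ∀ c g, 0 ≤ u c g)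
    (hu' : ∀ c g, 0 ≤ u' c g) {F : (C → γ) → ℝ}
    (h : ∀ c y, ∑ g, u c g * F (Function.update y c g) ≤
      ∑ g, u' c g * F (Function.update y c g)) : prodExp u F ≤ prodExp u' F := by
  -- Hybrid argument: the coordinates in `S` have already been switched to `u'`.
  have key : ∀ S : Finset C, prodExp u F ≤ prodExp (fun c => if c ∈ S then u' c else u c) F := by
    intro S
    induction S using Finset.induction_on with
    | empty => simp
    | insert c S hc ih =>
      refine ih.trans (prodExp_le_of_coord (fun j g => ?_) c (fun j hj => ?_) fun y => ?_)
      · split_ifs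
        exacts [hu' _ _, hu _ _]
      · simp [hj]
      · simpa [hc] using h c y
  simpa using key Finset.univ

end ProductExpectation

/-! ### Harris' and Janson's inequalities -/

section Janson

/-- The weights of a Bernoulli variable with parameter `p`. -/
def bern (p : ℝ) (b : Bool) : ℝ := if b then p else 1 - p

theorem bern_nonneg {p : ℝ} (h0 : 0 ≤ p) (h1 : p ≤ 1) (b : Bool) : 0 ≤ bern p b := by
  cases b <;> simp [bern, h0, h1]

theorem sum_bern (p : ℝ) : ∑ b, bern p b = 1 := by simp [bern]

/-- Expectation of a function of independent Bernoulli bits with parameter `p`. -/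
noncomputable def bernExp {β : Type*} [Fintype β] [DecidableEq β] (p : ℝ) (F : (β → Bool) → ℝ) : ℝ :=
  prodExp (fun _ => bern p) F

/-- The indicator of the event that all bits in `s` are set. -/
noncomputable def allSet {β : Type*} (s : Finset β) (y : β → Bool) : ℝ :=
  open Classical in if ∀ b ∈ s, y b = true then 1 else 0

/-- The indicator of the event that for no `i ∈ T` all bits in `s i` are set. -/
noncomputable def noneSet {β ι : Type*} (s : ι → Finset β) (T : Finset ι) (y : β → Bool) : ℝ :=
  ∏ i ∈ T, (1 - allSet (s i) y)

theorem allSet_nonneg {β : Type*} (s : Finset β) (y : β → Bool) : 0 ≤ allSet s y := by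
  unfold allSet; split_ifs <;> norm_num

theorem allSet_le_one {β : Type*} (s : Finset β) (y : β → Bool) : allSet s y ≤ 1 := by
  unfold allSet; split_ifs <;> norm_num

theorem allSet_monotone {β : Type*} (s : Finset β) : Monotone (allSet s) := by
  intro y z hyz
  unfold allSet
  split_ifs with h1 h2 h2
  · rfl
  · exact absurd (fun b hb => by have := hyz b; rw [h1 b hb] at this; exact top_le_iff.1 this) h2
  · norm_num
  · rfl

theorem allSet_mul_allSet {β : Type*} [DecidableEq β] (s t : Finset β) (y : β → Bool) :
    allSet s y * allSet t y = allSet (s ∪ t) y := by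
  unfold allSet
  simp only [Finset.forall_mem_union]
  split_ifs <;> simp_all

theorem allSet_eq_prod {β : Type*} (s : Finset β) (y : β → Bool) :
    allSet s y = ∏ b ∈ s, if y b = true then 1 else 0 := by
  unfold allSet
  split_ifs with h
  · exact (Finset.prod_eq_one fun b hb => if_pos (h b hb)).symm
  · push Not at h
    obtain ⟨b, hb, hy⟩ := h
    exact (Finset.prod_eq_zero hb (if_neg hy)).symm

theorem allSet_update_of_notMem {β : Type*} [DecidableEq β] {s : Finset β} {b : β} (hb : b ∉ s)
    (y : β → Bool) (g : Bool) : allSet s (Function.update y b g) = allSet s y := by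
  rw [allSet_eq_prod, allSet_eq_prod]
  refine Finset.prod_congr rfl fun c hc => ?_
  rw [Function.update_of_ne (ne_of_mem_of_not_mem hc hb)]

theorem noneSet_mem_Icc {β ι : Type*} (s : ι → Finset β) (T : Finset ι) (y : β → Bool) :
    0 ≤ noneSet s T y ∧ noneSet s T y ≤ 1 :=
  ⟨Finset.prod_nonneg fun _ _ => sub_nonneg.2 (allSet_le_one _ _),
    Finset.prod_le_one (fun _ _ => sub_nonneg.2 (allSet_le_one _ _)) fun i _ => by
      linarith [allSet_nonneg (s i) y]⟩

theorem noneSet_antitone {β ι : Type*} (s : ι → Finset β) (T : Finset ι) :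
    Antitone (noneSet s T) := fun _ _ hyz =>
  Finset.prod_le_prod (fun _ _ => sub_nonneg.2 (allSet_le_one _ _))
    fun i _ => sub_le_sub_left (allSet_monotone (s i) hyz) 1

theorem one_sub_sum_le_noneSet {β ι : Type*} (s : ι → Finset β) (T : Finset ι) (y : β → Bool) :
    1 - ∑ i ∈ T, allSet (s i) y ≤ noneSet s T y := by
  classical
  induction T using Finset.induction_on with
  | empty => simp [noneSet]
  | insert i T hi ih =>
    have h1 := noneSet_mem_Icc s T y
    have h2 := allSet_nonneg (s i) y
    have h3 : noneSet s (insert i T) y = (1 - allSet (s i) y) * noneSet s T y :=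
      Finset.prod_insert hi
    rw [Finset.sum_insert hi, h3]
    nlinarith [mul_nonneg h2 (sub_nonneg.2 h1.2)]

variable {β ι : Type*} [Fintype β] [DecidableEq β]

/-- Independence: `F` does not depend on the bits in `s`. -/
theorem bernExp_allSet_mul {p : ℝ} (h0 : 0 ≤ p) (h1 : p ≤ 1) (s : Finset β)
    {F : (β → Bool) → ℝ} (hF : ∀ b ∈ s, ∀ y g, F (Function.update y b g) = F y) :
    bernExp p (fun y => allSet s y * F y) = p ^ s.card * bernExp p F := by
  induction s using Finset.induction_on with
  | empty => simp [allSet]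
  | insert b s hb ih =>
    have ih' := ih fun c hc => hF c (Finset.mem_insert_of_mem hc)
    rw [Finset.card_insert_of_notMem hb, pow_succ', mul_assoc, ← ih']
    unfold bernExp
    rw [← prodExp_const_mul]
    refine prodExp_congr_coord (fun _ g => bern_nonneg h0 h1 g) b fun y => ?_
    have hs : ∀ g, allSet (insert b s) (Function.update y b g) =
        (if g = true then 1 else 0) * allSet s y := fun g => by
      rw [← allSet_update_of_notMem hb y g, allSet_eq_prod, Finset.prod_insert hb,
        Function.update_self, ← allSet_eq_prod]
    simp only [hs, hF b (Finset.mem_insert_self b s), allSet_update_of_notMem hb]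
    simp only [Fintype.sum_bool, bern, if_true, Bool.false_eq_true, if_false]
    ring

theorem bernExp_allSet {p : ℝ} (h0 : 0 ≤ p) (h1 : p ≤ 1) (s : Finset β) :
    bernExp p (allSet s) = p ^ s.card := by
  have := bernExp_allSet_mul h0 h1 s (F := fun _ => 1) (fun _ _ _ _ => rfl)
  simp only [mul_one] at this
  refine this.trans ?_
  rw [bernExp, prodExp_one fun _ => sum_bern p, mul_one]

/-- Harris' inequality. -/
theorem bernExp_mul_le {p : ℝ} (h0 : 0 ≤ p) (h1 : p ≤ 1) {f g : (β → Bool) → ℝ}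
    (hf0 : ∀ y, 0 ≤ f y) (hf : Monotone f) (hg1 : ∀ y, g y ≤ 1) (hg : Antitone g) :
    bernExp p (fun y => f y * g y) ≤ bernExp p f * bernExp p g := by
  -- FKG for the increasing functions `f` and `1 - g`; for product weights its lattice condition is
  -- an equality.
  have h := fkg (μ := fun y : β → Bool => ∏ b, bern p (y b)) (f := f) (g := fun y => 1 - g y)
    (fun y => Finset.prod_nonneg fun b _ => bern_nonneg h0 h1 (y b)) hf0
    (fun y => sub_nonneg.2 (hg1 y)) hf (fun y z hyz => sub_le_sub_left (hg hyz) 1)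
    (fun a b => by
      simp only [← Finset.prod_mul_distrib]
      refine le_of_eq (Finset.prod_congr rfl fun c _ => ?_)
      simp only [Pi.inf_apply, Pi.sup_apply]
      cases a c <;> cases b c <;> simp [mul_comm])
  have h' : bernExp p f * bernExp p (fun y => 1 - g y) ≤
      1 * bernExp p (fun y => f y * (1 - g y)) := by
    have e : (∑ y : β → Bool, ∏ b, bern p (y b)) = 1 := by
      have := prodExp_one (C := β) (u := fun _ => bern p) fun _ => sum_bern p
      simpa [prodExp] using this
    rw [e] at h
    exact h
  simp only [mul_sub, mul_one, one_mul] at h'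
  unfold bernExp at *
  rw [prodExp_sub, prodExp_sub, prodExp_one fun _ => sum_bern p] at h'
  linarith

variable [DecidableEq ι]

/-- The induction step of Janson's inequality: event `i` is independent of the events disjoint from
it, and the others are handled by the union bound and Harris' inequality. -/
theorem bernExp_noneSet_insert_le {p : ℝ} (h0 : 0 ≤ p) (h1 : p ≤ 1) (s : ι → Finset β)
    {T : Finset ι} {i : ι} (hi : i ∉ T) :
    bernExp p (noneSet s (insert i T)) ≤ bernExp p (noneSet s T) *
      (1 - p ^ (s i).card + ∑ j ∈ T with ¬ Disjoint (s i) (s j), p ^ (s i ∪ s j).card) := by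
  set T₀ := T.filter fun j => Disjoint (s i) (s j) with hT₀
  set T₁ := T.filter fun j => ¬ Disjoint (s i) (s j) with hT₁
  have hu : ∀ (c : β) (g : Bool), 0 ≤ bern p g := fun _ g => bern_nonneg h0 h1 g
  have hsplit : ∀ y, noneSet s T y = noneSet s T₀ y * noneSet s T₁ y := fun y =>
    (Finset.prod_filter_mul_prod_filter_not T _ _).symm
  have hmono : bernExp p (noneSet s T) ≤ bernExp p (noneSet s T₀) := by
    refine prodExp_mono hu fun y => ?_
    rw [hsplit]
    exact mul_le_of_le_one_right (noneSet_mem_Icc s T₀ y).1 (noneSet_mem_Icc s T₁ y).2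
  have hnn : 0 ≤ bernExp p (noneSet s T) := by
    have := prodExp_mono (F := fun _ => 0) (G := noneSet s T) (u := fun _ => bern p) hu
      fun y => (noneSet_mem_Icc s T y).1
    simpa [prodExp, bernExp] using this
  have hins : bernExp p (noneSet s (insert i T)) =
      bernExp p (noneSet s T) - bernExp p (fun y => allSet (s i) y * noneSet s T y) := by
    unfold bernExp
    rw [← prodExp_sub]
    congr 1; funext y
    have h3 : noneSet s (insert i T) y = (1 - allSet (s i) y) * noneSet s T y :=
      Finset.prod_insert hi
    rw [h3]; ring
  have hindep : bernExp p (fun y => allSet (s i) y * noneSet s T₀ y) =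
      p ^ (s i).card * bernExp p (noneSet s T₀) := by
    refine bernExp_allSet_mul h0 h1 _ fun b hb y g => ?_
    refine Finset.prod_congr rfl fun j hj => ?_
    rw [allSet_update_of_notMem]
    exact Finset.disjoint_left.1 (Finset.mem_filter.1 hj).2 hb
  have hharris : ∀ j, bernExp p (fun y => allSet (s i ∪ s j) y * noneSet s T₀ y) ≤
      p ^ (s i ∪ s j).card * bernExp p (noneSet s T₀) := fun j => by
    rw [← bernExp_allSet h0 h1]
    exact bernExp_mul_le h0 h1 (allSet_nonneg _) (allSet_monotone _)
      (fun y => (noneSet_mem_Icc s T₀ y).2) (noneSet_antitone s T₀)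
  have hlow : bernExp p (fun y => allSet (s i) y * noneSet s T₀ y) -
      ∑ j ∈ T₁, bernExp p (fun y => allSet (s i ∪ s j) y * noneSet s T₀ y) ≤
      bernExp p (fun y => allSet (s i) y * noneSet s T y) := by
    unfold bernExp
    rw [← prodExp_sum, ← prodExp_sub]
    refine prodExp_mono hu fun y => ?_
    have h2 := one_sub_sum_le_noneSet s T₁ y
    have h3 := mul_le_mul_of_nonneg_left h2
      (mul_nonneg (allSet_nonneg (s i) y) (noneSet_mem_Icc s T₀ y).1)
    have h4 : ∑ j ∈ T₁, allSet (s i ∪ s j) y * noneSet s T₀ y =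
        allSet (s i) y * noneSet s T₀ y * ∑ j ∈ T₁, allSet (s j) y := by
      rw [Finset.mul_sum]
      refine Finset.sum_congr rfl fun j _ => ?_
      rw [← allSet_mul_allSet]; ring
    rw [hsplit, h4]
    linarith
  have hsum := Finset.sum_le_sum fun j (_ : j ∈ T₁) => hharris j
  rw [← Finset.sum_mul] at hsum
  rw [hins]
  set D := ∑ j ∈ T₁, p ^ (s i ∪ s j).card
  have h5 : bernExp p (noneSet s T₀) * (p ^ (s i).card - D) ≤
      bernExp p (fun y => allSet (s i) y * noneSet s T y) := by
    rw [hindep] at hlow; linarith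
  have h6 : 0 ≤ bernExp p (fun y => allSet (s i) y * noneSet s T y) := by
    have := prodExp_mono (F := fun _ => 0) (G := fun y => allSet (s i) y * noneSet s T y)
      (u := fun _ => bern p) hu
      fun y => mul_nonneg (allSet_nonneg _ _) (noneSet_mem_Icc s T y).1
    simpa [prodExp, bernExp] using this
  -- If this difference is negative, the claimed factor is at least `1` and monotonicity is enough.
  rcases le_total 0 (p ^ (s i).card - D) with h | h
  · nlinarith [mul_le_mul_of_nonneg_right hmono h]
  · nlinarith [mul_nonneg hnn (neg_nonneg.2 h)]

/-- Janson's inequality, with both orders of each dependent pair counted. -/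
theorem bernExp_noneSet_le_exp {p : ℝ} (h0 : 0 ≤ p) (h1 : p ≤ 1) (s : ι → Finset β)
    (T : Finset ι) :
    bernExp p (noneSet s T) ≤ Real.exp (-∑ i ∈ T, p ^ (s i).card +
      (∑ i ∈ T, ∑ j ∈ T with i ≠ j ∧ ¬ Disjoint (s i) (s j), p ^ (s i ∪ s j).card) / 2) := by
  induction T using Finset.induction_on with
  | empty =>
    have := prodExp_one (C := β) (u := fun _ => bern p) fun _ => sum_bern p
    have h : noneSet s ∅ = fun _ => 1 := funext fun y => Finset.prod_empty
    rw [bernExp, h, this]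
    simp
  | insert i T hi ih =>
    refine (bernExp_noneSet_insert_le h0 h1 s hi).trans ?_
    set D := ∑ j ∈ T with ¬ Disjoint (s i) (s j), p ^ (s i ∪ s j).card with hD
    have hexp : 1 - p ^ (s i).card + D ≤ Real.exp (-p ^ (s i).card + D) := by
      linarith [Real.add_one_le_exp (-p ^ (s i).card + D)]
    have hnn : 0 ≤ bernExp p (noneSet s T) := by
      have := prodExp_mono (F := fun _ => 0) (G := noneSet s T) (u := fun _ : β => bern p)
        (fun _ g => bern_nonneg h0 h1 g) fun y => (noneSet_mem_Icc s T y).1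
      simpa [prodExp, bernExp] using this
    refine (mul_le_mul_of_nonneg_left hexp hnn).trans
      ((mul_le_mul_of_nonneg_right ih (Real.exp_pos _).le).trans ?_)
    rw [← Real.exp_add]
    refine Real.exp_le_exp.2 (le_of_eq ?_)
    -- Row `i` and column `i` of the double sum each contribute `D`; the factor `1 / 2` leaves one
    -- `D`.
    have e1 : ∑ j ∈ insert i T with i ≠ j ∧ ¬ Disjoint (s i) (s j), p ^ (s i ∪ s j).card = D := by
      rw [hD]
      refine Finset.sum_congr ?_ fun _ _ => rfl
      ext j
      simp only [Finset.mem_filter, Finset.mem_insert]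
      constructor
      · rintro ⟨h | h, h2, h3⟩
        · exact absurd h.symm h2
        · exact ⟨h, h3⟩
      · rintro ⟨h, h3⟩
        exact ⟨Or.inr h, fun e => hi (e ▸ h), h3⟩
    have e2 : ∑ l ∈ T, ∑ j ∈ insert i T with l ≠ j ∧ ¬ Disjoint (s l) (s j),
        p ^ (s l ∪ s j).card = D +
        ∑ l ∈ T, ∑ j ∈ T with l ≠ j ∧ ¬ Disjoint (s l) (s j), p ^ (s l ∪ s j).card := by
      rw [hD, Finset.sum_filter, ← Finset.sum_add_distrib]
      refine Finset.sum_congr rfl fun l hl => ?_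
      have hli : l ≠ i := fun e => hi (e ▸ hl)
      rw [Finset.sum_filter, Finset.sum_filter, Finset.sum_insert hi]
      simp only [ne_eq, hli, not_false_eq_true, true_and, disjoint_comm (a := s l) (b := s i),
        Finset.union_comm (s l) (s i)]
    rw [Finset.sum_insert hi, Finset.sum_insert hi, e1, e2]
    ring

/-- The extended Janson inequality, the dependent pairs including the diagonal. -/
theorem bernExp_noneSet_le_exp_neg_sq [Fintype ι] {p : ℝ} (h0 : 0 < p) (h1 : p ≤ 1)
    (s : ι → Finset β) (hs : ∀ i, (s i).Nonempty) :
    bernExp p (noneSet s Finset.univ) ≤ Real.exp (-((∑ i, p ^ (s i).card) ^ 2 /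
      (2 * ∑ i, ∑ j with ¬ Disjoint (s i) (s j), p ^ (s i ∪ s j).card))) := by
  set μ := ∑ i, p ^ (s i).card with hμ
  set Δ := ∑ i, ∑ j with ¬ Disjoint (s i) (s j), p ^ (s i ∪ s j).card with hΔ
  set E := bernExp p (noneSet s Finset.univ) with hE
  have hμ0 : 0 ≤ μ := Finset.sum_nonneg fun i _ => by positivity
  have hμΔ : μ ≤ Δ := by
    refine Finset.sum_le_sum fun i _ => ?_
    have : i ∈ Finset.univ.filter fun j => ¬ Disjoint (s i) (s j) := by
      simp [Finset.nonempty_iff_ne_empty.1 (hs i)]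
    refine le_trans ?_ (Finset.single_le_sum (f := fun j => p ^ (s i ∪ s j).card)
      (fun j _ => by positivity) this)
    simp
  rcases le_or_gt E 0 with hE0 | hE0
  · exact hE0.trans (Real.exp_pos _).le
  rw [← Real.log_le_iff_le_exp hE0]
  have hΔ0 : 0 ≤ Δ := hμ0.trans hμΔ
  -- Each event is kept independently with probability `r`, the minimiser of `-r μ + r² Δ / 2`.
  -- Counting the diagonal in `Δ` ensures `r ≤ 1`.
  set r := μ / Δ with hr
  have hr0 : 0 ≤ r := div_nonneg hμ0 hΔ0
  have hr1 : r ≤ 1 := div_le_one_of_le₀ hμΔ hΔ0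
  let D : Finset (ι × ι) := Finset.univ.filter fun x => x.1 ≠ x.2 ∧ ¬ Disjoint (s x.1) (s x.2)
  -- The exponent in Janson's inequality for the kept events. It bounds `log E` for every `z`, hence
  -- so does its mean.
  let Φ : (ι → Bool) → ℝ := fun z =>
    (1 / 2) * (∑ x ∈ D, p ^ (s x.1 ∪ s x.2).card * allSet ({x.1} ∪ {x.2}) z) -
      ∑ i, p ^ (s i).card * allSet {i} z
  have hΦ : ∀ z, Real.log E ≤ Φ z := by
    intro z
    rw [Real.log_le_iff_le_exp hE0]
    set T := Finset.univ.filter fun i => z i = true with hT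
    have hle : E ≤ bernExp p (noneSet s T) := by
      refine prodExp_mono (fun _ g => bern_nonneg h0.le h1 g) fun y => ?_
      have : noneSet s T y * noneSet s (Finset.univ.filter fun i => ¬ z i = true) y =
          noneSet s Finset.univ y := Finset.prod_filter_mul_prod_filter_not _ _ _
      rw [← this]
      exact mul_le_of_le_one_right (noneSet_mem_Icc s T y).1 (noneSet_mem_Icc s _ y).2
    refine hle.trans ((bernExp_noneSet_le_exp h0.le h1 s T).trans
      (Real.exp_le_exp.2 (le_of_eq ?_)))
    have e1 : ∑ i, p ^ (s i).card * allSet {i} z = ∑ i ∈ T, p ^ (s i).card := by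
      rw [hT, Finset.sum_filter]
      exact Finset.sum_congr rfl fun i _ => by simp [allSet]
    have e2 : ∑ x ∈ D, p ^ (s x.1 ∪ s x.2).card * allSet ({x.1} ∪ {x.2}) z =
        ∑ i ∈ T, ∑ j ∈ T with i ≠ j ∧ ¬ Disjoint (s i) (s j), p ^ (s i ∪ s j).card := by
      simp only [D, hT, Finset.sum_filter, Fintype.sum_prod_type]
      refine Finset.sum_congr rfl fun i _ => ?_
      by_cases hi : z i = true
      · rw [if_pos hi]
        refine Finset.sum_congr rfl fun j _ => ?_
        by_cases hj : z j = true <;> simp [allSet, hi, hj]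
      · rw [if_neg hi]
        refine Finset.sum_eq_zero fun j _ => ?_
        simp [allSet, hi]
    simp only [Φ, e1, e2]
    ring
  have hconst : Real.log E = bernExp r fun _ : ι → Bool => Real.log E := by
    have := prodExp_const_mul (C := ι) (fun _ => bern r) (Real.log E) fun _ => 1
    rw [prodExp_one fun _ => sum_bern r] at this
    simpa [bernExp] using this.symm
  have hmean : bernExp r Φ =
      (1 / 2) * (∑ x ∈ D, p ^ (s x.1 ∪ s x.2).card * r ^ 2) - r * μ := by
    unfold bernExp
    simp only [Φ]
    rw [prodExp_sub, prodExp_const_mul, prodExp_sum, prodExp_sum]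
    simp only [prodExp_const_mul]
    congr 1
    · congr 1
      refine Finset.sum_congr rfl fun x hx => ?_
      have := bernExp_allSet hr0 hr1 ({x.1} ∪ {x.2} : Finset ι)
      rw [Finset.card_union_of_disjoint (by simpa using (Finset.mem_filter.1 hx).2.1)] at this
      simp only [Finset.card_singleton] at this
      rw [← this, bernExp]
    · rw [hμ, Finset.mul_sum]
      refine Finset.sum_congr rfl fun i _ => ?_
      have := bernExp_allSet hr0 hr1 ({i} : Finset ι)
      rw [Finset.card_singleton, pow_one, bernExp] at this
      rw [this, mul_comm]
  have hD : ∑ x ∈ D, p ^ (s x.1 ∪ s x.2).card ≤ Δ := by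
    rw [hΔ]
    simp only [D, Finset.sum_filter, Fintype.sum_prod_type]
    refine Finset.sum_le_sum fun i _ => Finset.sum_le_sum fun j _ => ?_
    by_cases h3 : ¬ Disjoint (s i) (s j)
    · rw [if_pos h3]
      split_ifs
      · exact le_rfl
      · positivity
    · rw [if_neg h3, if_neg fun h => h3 h.2]
  have hle : Real.log E ≤ bernExp r Φ := by
    rw [hconst]
    exact prodExp_mono (fun _ g => bern_nonneg hr0 hr1 g) hΦ
  rw [hmean, ← Finset.sum_mul] at hle
  refine hle.trans ?_
  have h5 := mul_le_mul_of_nonneg_right hD (sq_nonneg r)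
  -- If `Δ = 0` then `μ = 0` and, division by zero being `0`, the claimed bound is `0`.
  rcases hΔ0.eq_or_lt with h6 | h6
  · have hμz : μ = 0 := le_antisymm (h6 ▸ hμΔ) hμ0
    rw [← h6] at h5
    simp only [hμz]
    norm_num
    nlinarith
  · have h7 : r * Δ = μ := div_mul_cancel₀ _ h6.ne'
    have h8 : μ ^ 2 / (2 * Δ) = r * μ / 2 := by
      rw [← h7]; field_simp
    rw [h8]
    nlinarith

end Janson

/-! ### Random words compared with independent bits -/

theorem noneSet_eq_ite {β ι : Type*} (s : ι → Finset β) (T : Finset ι) (y : β → Bool) :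
    noneSet s T y = open Classical in if ∀ i ∈ T, ¬ ∀ b ∈ s i, y b = true then 1 else 0 := by
  unfold noneSet
  split_ifs with h
  · exact Finset.prod_eq_one fun i hi => by rw [allSet, if_neg (h i hi), sub_zero]
  · push Not at h
    obtain ⟨i, hi, hy⟩ := h
    exact Finset.prod_eq_zero hi (by rw [allSet, if_pos hy, sub_self])

theorem sum_prod_bern_avoid {q : ℕ} (p : ℝ) (W : Finset (Fin q)) :
    ∑ g : Fin q → Bool, (∏ a, bern p (g a)) * (if ∀ a ∈ W, g a = false then 1 else 0) =
      (1 - p) ^ W.card := by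
  have h := prodExp_prod (C := Fin q) (fun _ => bern p)
    (fun a b => if a ∈ W ∧ b = true then 0 else 1)
  have e : ∀ g : Fin q → Bool, (∏ a, if a ∈ W ∧ g a = true then (0 : ℝ) else 1) =
      if ∀ a ∈ W, g a = false then 1 else 0 := by
    intro g
    split_ifs with h
    · exact Finset.prod_eq_one fun a _ => if_neg fun h' => by simp [h a h'.1] at h'
    · push Not at h
      obtain ⟨a, ha, hg⟩ := h
      exact Finset.prod_eq_zero (Finset.mem_univ a) (if_pos ⟨ha, by simpa using hg⟩)
  simp only [prodExp, e] at h
  rw [h]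
  have e2 : ∀ a : Fin q, ∑ b, bern p b * (if a ∈ W ∧ b = true then 0 else 1) =
      if a ∈ W then 1 - p else 1 := by
    intro a
    by_cases ha : a ∈ W <;> simp [bern, ha]
  simp only [e2]
  rw [Finset.prod_ite_mem, Finset.univ_inter, Finset.prod_const]

/-- Families of patterns in a random word: `t i` is a partial function prescribing the letters at
some positions. The number of words which fit no pattern is at most what it would be if all the
events that position `c` carries letter `a` were independent of probability `1 / q`. -/
theorem card_avoid_le {C ι : Type*} [Fintype C] [DecidableEq C] [Fintype ι] {q : ℕ} (hq : 0 < q)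
    (t : ι → Finset (C × Fin q))
    (ht : ∀ i, ∀ x ∈ t i, ∀ y ∈ t i, x.1 = y.1 → x = y) :
    (Nat.card {ω : C → Fin q // ∀ i, ¬ ∀ x ∈ t i, ω x.1 = x.2} : ℝ) ≤
      (q : ℝ) ^ Fintype.card C * bernExp (1 / (q : ℝ)) (noneSet t Finset.univ) := by
  classical
  have hq' : (0 : ℝ) < q := by exact_mod_cast hq
  have hq1 : (1 : ℝ) ≤ q := by exact_mod_cast hq
  have hp0 : (0 : ℝ) ≤ 1 / q := by positivity
  have hp1 : 1 / (q : ℝ) ≤ 1 := by rw [div_le_one hq']; exact hq1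
  set p : ℝ := 1 / q with hp
  -- One-hot encoding: `u` is the law of a uniform letter, `u'` that of `q` independent bits.
  let single : Fin q → (Fin q → Bool) := fun a b => decide (b = a)
  let u : C → (Fin q → Bool) → ℝ := fun _ g => ∑ a, if g = single a then p else 0
  let u' : C → (Fin q → Bool) → ℝ := fun _ g => ∏ a, bern p (g a)
  let F : (C → Fin q → Bool) → ℝ := fun y => noneSet t Finset.univ fun x => y x.1 x.2
  have hu : ∀ c g, 0 ≤ u c g := fun c g => Finset.sum_nonneg fun a _ => by split_ifs <;> positivity
  have hu' : ∀ c g, 0 ≤ u' c g := fun c g => Finset.prod_nonneg fun a _ => bern_nonneg hp0 hp1 _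
  have hRHS : prodExp u' F = bernExp p (noneSet t Finset.univ) := by
    rw [bernExp, prodExp, prodExp, ← (Equiv.curry C (Fin q) Bool).sum_comp]
    refine Finset.sum_congr rfl fun y _ => ?_
    simp only [u', F, Fintype.prod_prod_type]
    rfl
  have hLHS : prodExp u F = p ^ Fintype.card C * ∑ ω : C → Fin q, F fun c => single (ω c) := by
    have h1 : ∀ y : C → Fin q → Bool, ∏ c, u c (y c) =
        ∑ ω : C → Fin q, if y = (fun c => single (ω c)) then p ^ Fintype.card C else 0 := by
      intro y
      simp only [u]
      rw [Finset.prod_univ_sum, Fintype.piFinset_univ]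
      refine Finset.sum_congr rfl fun ω _ => ?_
      split_ifs with h
      · rw [Finset.prod_congr rfl fun c _ => if_pos (congrFun h c)]
        simp
      · obtain ⟨c, hc⟩ := Function.ne_iff.1 h
        exact Finset.prod_eq_zero (Finset.mem_univ c) (if_neg hc)
    simp only [prodExp, h1, Finset.sum_mul]
    rw [Finset.sum_comm, Finset.mul_sum]
    refine Finset.sum_congr rfl fun ω _ => ?_
    simp
  have hcount : ∑ ω : C → Fin q, F (fun c => single (ω c)) =
      (Nat.card {ω : C → Fin q // ∀ i, ¬ ∀ x ∈ t i, ω x.1 = x.2} : ℝ) := by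
    rw [Nat.card_eq_fintype_card, Fintype.card_subtype, Finset.card_filter]
    push_cast
    refine Finset.sum_congr rfl fun ω _ => ?_
    simp only [F, noneSet_eq_ite, single, decide_eq_true_eq, Finset.mem_univ, true_imp_iff]
    simp only [eq_comm]
  have hkey : prodExp u F ≤ prodExp u' F := by
    refine prodExp_le_of_forall_coord hu hu' fun c y => ?_
    -- A pattern that does not touch `c` is already complete: both sides vanish.
    by_cases hA : ∃ i, (∀ x ∈ t i, x.1 ≠ c) ∧ ∀ x ∈ t i, y x.1 x.2 = true
    · obtain ⟨i, hi1, hi2⟩ := hA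
      have h0 : ∀ g, F (Function.update y c g) = 0 := fun g => by
        simp only [F, noneSet_eq_ite]
        refine if_neg fun h => h i (Finset.mem_univ i) fun x hx => ?_
        rw [Function.update_of_ne (hi1 x hx)]
        exact hi2 x hx
      simp [h0]
    -- The letters at `c` that would complete a pattern; by `ht` a pattern prescribes at most one
    -- letter there.
    · let W : Finset (Fin q) := Finset.univ.filter fun a =>
        ∃ i, (c, a) ∈ t i ∧ ∀ x ∈ t i, x.1 ≠ c → y x.1 x.2 = true
      have hF : ∀ g, F (Function.update y c g) = if ∀ a ∈ W, g a = false then 1 else 0 := by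
        intro g
        simp only [F, noneSet_eq_ite]
        have hiff : (∀ i ∈ Finset.univ, ¬ ∀ x ∈ t i, Function.update y c g x.1 x.2 = true) ↔
            ∀ a ∈ W, g a = false := by
          refine ⟨fun h a ha => ?_, fun h i _ hi => ?_⟩
          · obtain ⟨i, hi1, hi2⟩ := (Finset.mem_filter.1 ha).2
            by_contra hg
            refine h i (Finset.mem_univ i) fun x hx => ?_
            by_cases hxc : x.1 = c
            · rw [ht i x hx _ hi1 hxc]
              simpa using hg
            · rw [Function.update_of_ne hxc]
              exact hi2 x hx hxc
          · have hy : ∀ x ∈ t i, x.1 ≠ c → y x.1 x.2 = true := fun x hx hxc => by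
              have := hi x hx
              rwa [Function.update_of_ne hxc] at this
            have hex : ∃ x ∈ t i, x.1 = c := by
              by_contra hne
              push Not at hne
              exact hA ⟨i, hne, fun x hx => hy x hx (hne x hx)⟩
            obtain ⟨⟨_, a⟩, hx, rfl⟩ := hex
            have h1 := h a (Finset.mem_filter.2 ⟨Finset.mem_univ a, i, hx, hy⟩)
            have h2 := hi _ hx
            simp [h1] at h2
        simp only [hiff]
      simp only [hF, u, u', sum_prod_bern_avoid, Finset.sum_mul]
      rw [Finset.sum_comm]
      have e : ∀ a : Fin q, ∑ g : Fin q → Bool, (if g = single a then p else 0) *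
          (if ∀ a ∈ W, g a = false then (1 : ℝ) else 0) = if a ∈ W then 0 else p := by
        intro a
        simp only [ite_mul, zero_mul, Finset.sum_ite_eq', Finset.mem_univ, if_true, single,
          decide_eq_false_iff_not]
        by_cases ha : a ∈ W
        · have : ¬ ∀ b ∈ W, ¬ b = a := fun h => h a ha rfl
          simp only [ha, this, if_true, if_false, mul_zero]
        · have : ∀ b ∈ W, ¬ b = a := fun b hb hba => ha (hba ▸ hb)
          simp only [ha, if_false, if_pos this, mul_one]
      simp only [e]
      have e2 : ∑ a : Fin q, (if a ∈ W then (0 : ℝ) else p) = 1 + W.card * (-p) := by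
        have : ∀ a : Fin q, (if a ∈ W then (0 : ℝ) else p) = p - if a ∈ W then p else 0 :=
          fun a => by split_ifs <;> ring
        simp only [this, Finset.sum_sub_distrib, Finset.sum_ite_mem, Finset.univ_inter,
          Finset.sum_const, Finset.card_univ, Fintype.card_fin, nsmul_eq_mul]
        rw [hp]
        field_simp
        ring
      rw [e2, sub_eq_add_neg]
      -- Bernoulli's inequality `1 - |W| p ≤ (1 - p) ^ |W|`, the avoidance probabilities under the
      -- two laws.
      exact one_add_mul_le_pow (by linarith) _
  rw [hRHS, hLHS, hcount] at hkey
  have hpq : (q : ℝ) ^ Fintype.card C * p ^ Fintype.card C = 1 := by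
    rw [← mul_pow, hp, mul_one_div_cancel hq'.ne', one_pow]
  calc _ = (q : ℝ) ^ Fintype.card C * (p ^ Fintype.card C *
        (Nat.card {ω : C → Fin q // ∀ i, ¬ ∀ x ∈ t i, ω x.1 = x.2} : ℝ)) := by
        rw [← mul_assoc, hpq, one_mul]
    _ ≤ _ := mul_le_mul_of_nonneg_left hkey (by positivity)

/-! ### Second moment of the overlaps -/

theorem prod_le_sum_pow_div {d : ℕ} (hd : 0 < d) (s : Fin d → ℕ) :
    (∏ t, (s t : ℝ)) ≤ ∑ t, (s t : ℝ) ^ d / d := by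
  have hd' : (d : ℝ) ≠ 0 := by exact_mod_cast hd.ne'
  have h := Real.geom_mean_le_arith_mean_weighted (Finset.univ : Finset (Fin d))
    (fun _ => (d : ℝ)⁻¹) (fun t => (s t : ℝ) ^ d) (fun _ _ => by positivity)
    (by simp [hd']) (fun _ _ => by positivity)
  have e : ∀ t, ((s t : ℝ) ^ d) ^ (d : ℝ)⁻¹ = s t := fun t =>
    Real.pow_rpow_inv_natCast (by positivity) hd.ne'
  simp only [e] at h
  refine h.trans (le_of_eq (Finset.sum_congr rfl fun t _ => by ring))

/-- The `s`-th weight in the second moment computation: up to normalisation, the contribution of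
the pairs of `k`-subsets which share `s` elements. -/
noncomputable def overlapWeight (d q s : ℕ) : ℝ :=
  -- Copies with disjoint coordinate sets in some direction share no cell and do not enter `Δ`.
  if s = 0 then 0 else (q : ℝ) ^ ((s : ℝ) ^ d / d)

/-- The normalised second moment of one coordinate. -/
noncomputable def overlapSum (d q n k : ℕ) : ℝ :=
  ∑ s ∈ Finset.Icc 1 k, (k.choose s : ℝ) ^ 2 / n.choose s * (q : ℝ) ^ ((s : ℝ) ^ d / d)

theorem overlapWeight_nonneg (d q s : ℕ) : 0 ≤ overlapWeight d q s := by
  unfold overlapWeight; split_ifs <;> positivity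

theorem pow_prod_le_prod_overlapWeight {d q : ℕ} (hd : 0 < d) (hq : 0 < q) (s : Fin d → ℕ)
    (hs : ∀ t, s t ≠ 0) : (q : ℝ) ^ (∏ t, s t) ≤ ∏ t, overlapWeight d q (s t) := by
  have hq' : (1 : ℝ) ≤ q := by exact_mod_cast hq
  have hq0 : (0 : ℝ) < q := by linarith
  have e : ∏ t, overlapWeight d q (s t) = (q : ℝ) ^ (∑ t, (s t : ℝ) ^ d / d) := by
    rw [Real.rpow_sum_of_pos hq0]
    exact Finset.prod_congr rfl fun t _ => if_neg (hs t)
  rw [e, ← Real.rpow_natCast]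
  refine Real.rpow_le_rpow_of_exponent_le hq' ?_
  push_cast
  exact prod_le_sum_pow_div hd s

/-- Choose the intersection inside `a`, then extend it to a `k`-set; only an upper bound, as the
extension may meet `a` again. -/
theorem card_filter_card_inter_le {n k s : ℕ} (a : Finset (Fin n)) (ha : a.card = k) (hs : s ≤ k) :
    (Finset.univ.filter fun b : {b : Finset (Fin n) // b.card = k} =>
      (a ∩ b.1).card = s).card ≤ k.choose s * (n - s).choose (k - s) := by
  classical
  have h1 : (Finset.univ.filter fun b : {b : Finset (Fin n) // b.card = k} =>
      (a ∩ b.1).card = s).card ≤ ((a.powersetCard s).biUnion fun c =>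
        (Finset.univ.powersetCard k).filter (c ⊆ ·)).card := by
    refine Finset.card_le_card_of_injOn Subtype.val (fun b hb => ?_) Subtype.val_injective.injOn
    have hb' := (Finset.mem_filter.1 hb).2
    simp only [Finset.coe_biUnion, Set.mem_iUnion, Finset.mem_coe, Finset.mem_filter,
      Finset.mem_powersetCard]
    exact ⟨a ∩ b.1, ⟨Finset.inter_subset_left, hb'⟩, ⟨Finset.subset_univ _, b.2⟩,
      Finset.inter_subset_right⟩
  refine h1.trans (Finset.card_biUnion_le.trans (le_of_eq ?_))
  rw [Finset.sum_congr rfl fun c hc => ?_, Finset.sum_const, Finset.card_powersetCard, ha,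
    smul_eq_mul]
  have hc' := (Finset.mem_powersetCard.1 hc).2
  rw [Finset.card_filter_powersetCard_subset c _ k (Finset.subset_univ c) (hc'.le.trans hs), hc',
    Finset.card_univ, Fintype.card_fin]

theorem sum_overlapWeight_le {d q n k : ℕ} (hkn : k ≤ n) :
    ∑ a : {b : Finset (Fin n) // b.card = k}, ∑ b : {b : Finset (Fin n) // b.card = k},
      overlapWeight d q (a.1 ∩ b.1).card ≤ (n.choose k : ℝ) ^ 2 * overlapSum d q n k := by
  classical
  have hinner : ∀ a : {b : Finset (Fin n) // b.card = k},
      ∑ b : {b : Finset (Fin n) // b.card = k}, overlapWeight d q (a.1 ∩ b.1).card ≤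
        (n.choose k : ℝ) * overlapSum d q n k := by
    intro a
    have hw : ∀ b : {b : Finset (Fin n) // b.card = k}, overlapWeight d q (a.1 ∩ b.1).card =
        ∑ s ∈ Finset.Icc 1 k, if (a.1 ∩ b.1).card = s then (q : ℝ) ^ ((s : ℝ) ^ d / d) else 0 := by
      intro b
      have hle : (a.1 ∩ b.1).card ≤ k :=
        (Finset.card_le_card Finset.inter_subset_left).trans a.2.le
      rw [Finset.sum_ite_eq, overlapWeight]
      simp only [Finset.mem_Icc, hle, and_true, Nat.one_le_iff_ne_zero]
      split_ifs <;> simp_all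
    simp only [hw]
    rw [Finset.sum_comm, overlapSum, Finset.mul_sum]
    refine Finset.sum_le_sum fun s hs => ?_
    have hsk := (Finset.mem_Icc.1 hs).2
    rw [← Finset.sum_filter, Finset.sum_const, nsmul_eq_mul, ← mul_assoc]
    refine mul_le_mul_of_nonneg_right ?_ (by positivity)
    refine (Nat.cast_le.2 (card_filter_card_inter_le a.1 a.2 hsk)).trans (le_of_eq ?_)
    have hpos : (0 : ℝ) < n.choose s := by exact_mod_cast Nat.choose_pos (hsk.trans hkn)
    -- Both sides count pairs of an `s`-set inside a `k`-set.
    have hmul : (n.choose k : ℝ) * k.choose s = n.choose s * (n - s).choose (k - s) := by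
      exact_mod_cast Nat.choose_mul hsk
    push_cast
    rw [← mul_div_assoc, eq_div_iff hpos.ne']
    linear_combination (-(k.choose s : ℝ)) * hmul
  refine (Finset.sum_le_sum fun a _ => hinner a).trans (le_of_eq ?_)
  simp [Finset.card_univ]
  ring

/-! ### Copies of a target array and the union bound -/

section Patterns

variable {d q n k : ℕ}

/-- The letters prescribed by the requirement that the subarray with coordinate sets `I` is `B`. -/
def subarrayPattern (B : (Fin d → Fin k) → Fin q)
    (I : Fin d → {b : Finset (Fin n) // b.card = k}) : Finset ((Fin d → Fin n) × Fin q) :=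
  Finset.univ.image fun i => (fun t => (I t).1.orderEmbOfFin (I t).2 (i t), B i)

theorem subarray_injective (I : Fin d → {b : Finset (Fin n) // b.card = k}) :
    Function.Injective fun (i : Fin d → Fin k) t => (I t).1.orderEmbOfFin (I t).2 (i t) :=
  fun _ _ h => funext fun t => ((I t).1.orderEmbOfFin (I t).2).injective (congrFun h t)

theorem subarrayPattern_functional (B : (Fin d → Fin k) → Fin q)
    (I : Fin d → {b : Finset (Fin n) // b.card = k}) :
    ∀ x ∈ subarrayPattern B I, ∀ y ∈ subarrayPattern B I, x.1 = y.1 → x = y := by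
  simp only [subarrayPattern, Finset.mem_image, Finset.mem_univ, true_and]
  rintro _ ⟨i, rfl⟩ _ ⟨j, rfl⟩ h
  rw [subarray_injective I h]

theorem card_subarrayPattern (B : (Fin d → Fin k) → Fin q)
    (I : Fin d → {b : Finset (Fin n) // b.card = k}) :
    (subarrayPattern B I).card = k ^ d := by
  rw [subarrayPattern, Finset.card_image_of_injective]
  · simp
  · exact fun i j h => subarray_injective I (congrArg Prod.fst h)

theorem fst_mem_of_mem_subarrayPattern {B : (Fin d → Fin k) → Fin q}
    {I : Fin d → {b : Finset (Fin n) // b.card = k}} {x : (Fin d → Fin n) × Fin q}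
    (hx : x ∈ subarrayPattern B I) (t : Fin d) : x.1 t ∈ (I t).1 := by
  simp only [subarrayPattern, Finset.mem_image, Finset.mem_univ, true_and] at hx
  obtain ⟨i, rfl⟩ := hx
  exact Finset.orderEmbOfFin_mem _ _ _

/-- Shared prescriptions project injectively to cells in the box of common coordinates. -/
theorem card_inter_subarrayPattern_le (B : (Fin d → Fin k) → Fin q)
    (I J : Fin d → {b : Finset (Fin n) // b.card = k}) :
    (subarrayPattern B I ∩ subarrayPattern B J).card ≤ ∏ t, ((I t).1 ∩ (J t).1).card := by
  rw [← Fintype.card_piFinset]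
  refine Finset.card_le_card_of_injOn Prod.fst (fun x hx => ?_) fun x hx y hy h => ?_
  · have hx' := Finset.mem_inter.1 hx
    exact Fintype.mem_piFinset.2 fun t => Finset.mem_inter.2
      ⟨fst_mem_of_mem_subarrayPattern hx'.1 t, fst_mem_of_mem_subarrayPattern hx'.2 t⟩
  · exact subarrayPattern_functional B I x (Finset.mem_inter.1 hx).1 y (Finset.mem_inter.1 hy).1 h

/-- This is `Δ ≤ μ² G ^ d`: AM-GM makes the bound on each pair a product, so the sum over pairs is a
`d`-th power. -/
theorem sum_pow_card_union_subarrayPattern_le (hd : 0 < d) (hq : 0 < q) (hkn : k ≤ n)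
    (B : (Fin d → Fin k) → Fin q) :
    ∑ I : Fin d → {b : Finset (Fin n) // b.card = k},
      ∑ J with ¬ Disjoint (subarrayPattern B I) (subarrayPattern B J),
        (1 / (q : ℝ)) ^ (subarrayPattern B I ∪ subarrayPattern B J).card ≤
      ((n.choose k : ℝ) ^ d * (1 / (q : ℝ)) ^ k ^ d) ^ 2 * overlapSum d q n k ^ d := by
  have hq0 : (0 : ℝ) < q := by exact_mod_cast hq
  have hterm : ∀ I J : Fin d → {b : Finset (Fin n) // b.card = k},
      (if ¬ Disjoint (subarrayPattern B I) (subarrayPattern B J) then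
        (1 / (q : ℝ)) ^ (subarrayPattern B I ∪ subarrayPattern B J).card else 0) ≤
      ((1 / (q : ℝ)) ^ k ^ d) ^ 2 * ∏ t, overlapWeight d q ((I t).1 ∩ (J t).1).card := by
    intro I J
    by_cases h : ¬ Disjoint (subarrayPattern B I) (subarrayPattern B J)
    · rw [if_pos h]
      obtain ⟨x, hx1, hx2⟩ := Finset.not_disjoint_iff.1 h
      have hne : ∀ t, ((I t).1 ∩ (J t).1).card ≠ 0 := fun t => Finset.card_ne_zero_of_mem
        (Finset.mem_inter.2 ⟨fst_mem_of_mem_subarrayPattern hx1 t,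
          fst_mem_of_mem_subarrayPattern hx2 t⟩)
      have h1 := pow_prod_le_prod_overlapWeight hd hq _ hne
      have h2 : (q : ℝ) ^ (subarrayPattern B I ∩ subarrayPattern B J).card ≤
          (q : ℝ) ^ ∏ t, ((I t).1 ∩ (J t).1).card :=
        pow_le_pow_right₀ (by exact_mod_cast hq) (card_inter_subarrayPattern_le B I J)
      have h3 := Finset.card_union_add_card_inter (subarrayPattern B I) (subarrayPattern B J)
      rw [card_subarrayPattern, card_subarrayPattern] at h3
      have h4 : (1 / (q : ℝ)) ^ (subarrayPattern B I ∪ subarrayPattern B J).card =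
          ((1 / (q : ℝ)) ^ k ^ d) ^ 2 *
            (q : ℝ) ^ (subarrayPattern B I ∩ subarrayPattern B J).card := by
        rw [sq, ← pow_add, ← h3, pow_add, mul_assoc, ← mul_pow, one_div_mul_cancel hq0.ne',
          one_pow, mul_one]
      rw [h4]
      exact mul_le_mul_of_nonneg_left (h2.trans h1) (by positivity)
    · rw [if_neg h]
      exact mul_nonneg (by positivity) (Finset.prod_nonneg fun t _ => overlapWeight_nonneg _ _ _)
  simp only [Finset.sum_filter]
  refine (Finset.sum_le_sum fun I _ => Finset.sum_le_sum fun J _ => hterm I J).trans ?_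
  simp only [← Finset.mul_sum]
  have h5 : ∑ I : Fin d → {b : Finset (Fin n) // b.card = k},
      ∑ J : Fin d → {b : Finset (Fin n) // b.card = k},
        ∏ t, overlapWeight d q ((I t).1 ∩ (J t).1).card =
      (∑ a : {b : Finset (Fin n) // b.card = k}, ∑ b : {b : Finset (Fin n) // b.card = k},
        overlapWeight d q (a.1 ∩ b.1).card) ^ d := by
    have h6 : ∀ I : Fin d → {b : Finset (Fin n) // b.card = k},
        ∑ J : Fin d → {b : Finset (Fin n) // b.card = k},
          ∏ t, overlapWeight d q ((I t).1 ∩ (J t).1).card =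
        ∏ t, ∑ b : {b : Finset (Fin n) // b.card = k},
          overlapWeight d q ((I t).1 ∩ b.1).card := fun I => by
      rw [Finset.prod_univ_sum, Fintype.piFinset_univ]
    simp only [h6]
    have := Finset.prod_univ_sum (fun _ : Fin d => (Finset.univ :
      Finset {b : Finset (Fin n) // b.card = k})) fun _ a =>
        ∑ b : {b : Finset (Fin n) // b.card = k}, overlapWeight d q (a.1 ∩ b.1).card
    rw [Fintype.piFinset_univ] at this
    rw [← this, Finset.prod_const, Finset.card_univ, Fintype.card_fin]
  rw [h5]
  refine (mul_le_mul_of_nonneg_left (pow_le_pow_left₀ (Finset.sum_nonneg fun a _ =>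
    Finset.sum_nonneg fun b _ => overlapWeight_nonneg _ _ _) (sum_overlapWeight_le hkn) d)
    (by positivity)).trans (le_of_eq ?_)
  ring

theorem overlapSum_pos (hq : 0 < q) (hk : 1 ≤ k) (hkn : k ≤ n) : 0 < overlapSum d q n k := by
  have hq0 : (0 : ℝ) < q := by exact_mod_cast hq
  refine Finset.sum_pos (fun s hs => ?_) ⟨1, Finset.mem_Icc.2 ⟨le_rfl, hk⟩⟩
  have hsk := (Finset.mem_Icc.1 hs).2
  have h1 : (0 : ℝ) < k.choose s := by exact_mod_cast Nat.choose_pos hsk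
  have h2 : (0 : ℝ) < n.choose s := by exact_mod_cast Nat.choose_pos (hsk.trans hkn)
  positivity

/-- The number of arrays of order `n` which do not contain `B`. -/
theorem card_avoid_subarray_le (hd : 0 < d) (hq : 0 < q) (hk : 1 ≤ k) (hkn : k ≤ n)
    (B : (Fin d → Fin k) → Fin q) :
    (Nat.card {ω : (Fin d → Fin n) → Fin q // ∀ I : Fin d → {b : Finset (Fin n) // b.card = k},
      ¬ ∀ x ∈ subarrayPattern B I, ω x.1 = x.2} : ℝ) ≤
      (q : ℝ) ^ n ^ d * Real.exp (-(1 / (2 * overlapSum d q n k ^ d))) := by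
  have hq0 : (0 : ℝ) < q := by exact_mod_cast hq
  have hq1 : (1 : ℝ) ≤ q := by exact_mod_cast hq
  have h := card_avoid_le hq (subarrayPattern (n := n) B) (subarrayPattern_functional B)
  have hC : Fintype.card (Fin d → Fin n) = n ^ d := by simp
  rw [hC] at h
  refine h.trans (mul_le_mul_of_nonneg_left ?_ (by positivity))
  refine (bernExp_noneSet_le_exp_neg_sq (by positivity) (by rw [div_le_one hq0]; exact hq1) _
    fun I => Finset.card_pos.1 (by rw [card_subarrayPattern]; positivity)).trans
    (Real.exp_le_exp.2 (neg_le_neg ?_))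
  have hΔ := sum_pow_card_union_subarrayPattern_le hd hq hkn B
  have hμ : ∑ I : Fin d → {b : Finset (Fin n) // b.card = k},
      (1 / (q : ℝ)) ^ (subarrayPattern B I).card =
      (n.choose k : ℝ) ^ d * (1 / (q : ℝ)) ^ k ^ d := by
    simp [card_subarrayPattern]
  rw [hμ]
  set m := (n.choose k : ℝ) ^ d * (1 / (q : ℝ)) ^ k ^ d
  have hm : 0 < m := by
    have : (0 : ℝ) < n.choose k := by exact_mod_cast Nat.choose_pos hkn
    positivity
  have hG : 0 < overlapSum d q n k ^ d := pow_pos (overlapSum_pos hq hk hkn) d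
  set G := overlapSum d q n k ^ d
  have hΔ0 : 0 < ∑ I : Fin d → {b : Finset (Fin n) // b.card = k},
      ∑ J with ¬ Disjoint (subarrayPattern B I) (subarrayPattern B J),
        (1 / (q : ℝ)) ^ (subarrayPattern B I ∪ subarrayPattern B J).card := by
    have hK : Nonempty (Fin d → {b : Finset (Fin n) // b.card = k}) := by
      obtain ⟨b, -, hb⟩ := Finset.exists_subset_card_eq (s := (Finset.univ : Finset (Fin n)))
        (n := k) (by simpa using hkn)
      exact ⟨fun _ => ⟨b, hb⟩⟩
    refine Finset.sum_pos (fun I _ => Finset.sum_pos (fun J _ => by positivity) ⟨I, ?_⟩)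
      Finset.univ_nonempty
    have : (subarrayPattern B I).Nonempty :=
      Finset.card_pos.1 (by rw [card_subarrayPattern]; positivity)
    simp [Finset.nonempty_iff_ne_empty.1 this]
  have key : ∀ x : ℝ, 0 < x → x ≤ m ^ 2 * G → 1 / (2 * G) ≤ m ^ 2 / (2 * x) := by
    intro x hx hxG
    rw [div_le_div_iff₀ (by positivity) (by positivity)]
    linarith
  exact key _ hΔ0 hΔ

/-- If the normalised second moment is small, then some array of order `n` is `k`-universal. -/
theorem mem_universalOrders_of_overlapSum (hd : 0 < d) (hq : 0 < q) (hk : 1 ≤ k) (hkn : k ≤ n)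
    (h : 2 * ((k : ℝ) ^ d * Real.log q) * overlapSum d q n k ^ d < 1) :
    n ∈ DArray.universalOrders d q k := by
  classical
  have hq0 : (0 : ℝ) < q := by exact_mod_cast hq
  have hG : 0 < overlapSum d q n k ^ d := pow_pos (overlapSum_pos hq hk hkn) d
  by_contra hno
  have hall : ∀ ω : (Fin d → Fin n) → Fin q, ∃ B : (Fin d → Fin k) → Fin q,
      ∀ I : Fin d → {b : Finset (Fin n) // b.card = k},
        ¬ ∀ x ∈ subarrayPattern B I, ω x.1 = x.2 := by
    intro ω
    by_contra hcon
    push Not at hcon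
    refine hno ⟨ω, DArray.isUniversal_of_forall_order hq fun B => ?_⟩
    obtain ⟨I, hI⟩ := hcon B
    refine DArray.contains_iff.2 ⟨fun t => (I t).1.orderEmbOfFin (I t).2,
      fun t => ((I t).1.orderEmbOfFin (I t).2).strictMono, fun i => ?_⟩
    exact (hI _ (Finset.mem_image_of_mem _ (Finset.mem_univ i))).symm
  choose f hf using hall
  let bad : ((Fin d → Fin k) → Fin q) → Type := fun B =>
    {ω : (Fin d → Fin n) → Fin q // ∀ I : Fin d → {b : Finset (Fin n) // b.card = k},
      ¬ ∀ x ∈ subarrayPattern B I, ω x.1 = x.2}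
  -- Union bound: each array is paired with a target that it misses.
  have hinj : Function.Injective fun ω : (Fin d → Fin n) → Fin q =>
      (⟨f ω, ω, hf ω⟩ : Σ B, bad B) := fun ω ω' hω => by
    exact congrArg (fun x : Σ B, bad B => x.2.1) hω
  have hcard := Nat.card_le_card_of_injective _ hinj
  rw [Nat.card_sigma] at hcard
  have hcard' : (q : ℝ) ^ n ^ d ≤ ∑ B, (Nat.card (bad B) : ℝ) := by
    have e : Nat.card ((Fin d → Fin n) → Fin q) = q ^ n ^ d := by simp
    rw [e] at hcard
    exact_mod_cast hcard
  have hsum := Finset.sum_le_sum fun B (_ : B ∈ Finset.univ) =>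
    card_avoid_subarray_le (n := n) hd hq hk hkn B
  have hlt : (q : ℝ) ^ k ^ d * Real.exp (-(1 / (2 * overlapSum d q n k ^ d))) < 1 := by
    have e : (q : ℝ) ^ k ^ d = Real.exp ((k : ℝ) ^ d * Real.log q) := by
      rw [← Real.exp_log hq0, ← Real.exp_nat_mul, Real.exp_log hq0]
      push_cast
      rfl
    rw [e, ← Real.exp_add, Real.exp_lt_one_iff, ← sub_eq_add_neg, sub_neg, lt_div_iff₀ (by positivity)]
    linarith
  have hN : (0 : ℝ) < (q : ℝ) ^ n ^ d := by positivity
  simp only [Finset.sum_const, Finset.card_univ, Fintype.card_fun, Fintype.card_fin,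
    nsmul_eq_mul] at hsum
  push_cast at hsum
  have := hcard'.trans hsum
  nlinarith

end Patterns

/-! ### The lower bound -/

/-- The asymptotic value of `f_d(q, k)`. -/
noncomputable def asymptoticOrder (d q k : ℕ) : ℝ :=
  (k : ℝ) / Real.exp 1 * (q : ℝ) ^ ((k : ℝ) ^ (d - 1) / (d : ℝ))

theorem asymptoticOrder_pos {d q k : ℕ} (hq : 0 < q) (hk : 1 ≤ k) : 0 < asymptoticOrder d q k := by
  have : (0 : ℝ) < q := by exact_mod_cast hq
  have : (0 : ℝ) < k := by exact_mod_cast hk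
  unfold asymptoticOrder
  positivity

theorem asymptoticOrder_le_of_mem {d q n k : ℕ} (hd : 0 < d) (hq : 0 < q) (hk : 1 ≤ k)
    (hn : n ∈ DArray.universalOrders d q k) : asymptoticOrder d q k ≤ n := by
  obtain ⟨A, hA⟩ := hn
  have hq0 : (0 : ℝ) < q := by exact_mod_cast hq
  have hk0 : (0 : ℝ) < k := by exact_mod_cast hk
  have hd0 : (d : ℝ) ≠ 0 := by exact_mod_cast hd.ne'
  have he := Real.exp_pos 1
  set Q : ℝ := (q : ℝ) ^ ((k : ℝ) ^ (d - 1) / (d : ℝ)) with hQ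
  have hQ0 : 0 < Q := by positivity
  have h1 : (Q ^ k) ^ d ≤ (n.choose k : ℝ) ^ d := by
    have e : (Q ^ k) ^ d = (q : ℝ) ^ k ^ d := by
      rw [← pow_mul, hQ, ← Real.rpow_mul_natCast hq0.le, ← Real.rpow_natCast (q : ℝ) (k ^ d)]
      congr 1
      push_cast
      rw [mul_comm (k : ℝ), ← mul_assoc, div_mul_cancel₀ _ hd0, ← pow_succ,
        Nat.sub_add_cancel hd]
    rw [e]
    exact_mod_cast hA.pow_le_choose_pow
  have h2 : Q ^ k ≤ n.choose k := (pow_le_pow_iff_left₀ (by positivity) (by positivity) hd.ne').1 h1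
  have h3 : (n.choose k : ℝ) ≤ (n * Real.exp 1 / k) ^ k := by
    refine (Nat.choose_le_pow_div k n).trans ?_
    -- `k ^ k / k! ≤ e ^ k` is one term of the exponential series.
    have h4 := Real.pow_div_factorial_le_exp (k : ℝ) hk0.le k
    have h5 : Real.exp k = Real.exp 1 ^ k := by rw [← Real.exp_nat_mul, mul_one]
    have hf : (0 : ℝ) < k.factorial := by exact_mod_cast k.factorial_pos
    rw [h5, div_le_iff₀ hf] at h4
    rw [div_pow, mul_pow, div_le_div_iff₀ hf (by positivity), mul_assoc]
    exact mul_le_mul_of_nonneg_left h4 (by positivity)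
  have h6 : Q ≤ n * Real.exp 1 / k :=
    (pow_le_pow_iff_left₀ hQ0.le (by positivity) (by omega)).1 (h2.trans h3)
  rw [le_div_iff₀ hk0] at h6
  unfold asymptoticOrder
  rw [← hQ, div_mul_eq_mul_div, div_le_iff₀ he]
  linarith

/-! ### The overlap sum is exponentially small -/

/-- One-sided Stirling bound; the induction step is `e ≤ (1 + 1/k) ^ (k+1)`. -/
theorem factorial_le_exp_mul_pow {k : ℕ} (hk : 1 ≤ k) :
    (k.factorial : ℝ) ≤ Real.exp 1 * k * (k / Real.exp 1) ^ k := by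
  have he := Real.exp_pos 1
  induction k, hk using Nat.le_induction with
  | base => simp [he.ne']
  | succ k hk ih =>
    have hk0 : (0 : ℝ) < k := by exact_mod_cast hk
    have h1 : Real.exp 1 ≤ ((k + 1 : ℝ) / k) ^ (k + 1) := by
      have h2 := Real.one_sub_inv_le_log_of_pos (x := (k + 1 : ℝ) / k) (by positivity)
      have h3 : 1 - ((k + 1 : ℝ) / k)⁻¹ = 1 / (k + 1) := by field_simp; ring
      rw [h3, div_le_iff₀ (by positivity)] at h2
      rw [← Real.exp_log (x := ((k + 1 : ℝ) / k) ^ (k + 1)) (by positivity), Real.log_pow]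
      refine Real.exp_le_exp.2 ?_
      push_cast
      linarith
    rw [div_pow, le_div_iff₀ (by positivity)] at h1
    rw [Nat.factorial_succ]
    push_cast
    refine (mul_le_mul_of_nonneg_left ih (by positivity)).trans ?_
    have h4 : Real.exp 1 * k * (k / Real.exp 1) ^ k ≤
        Real.exp 1 * ((k + 1) / Real.exp 1) ^ (k + 1) := by
      rw [div_pow, div_pow, pow_succ (Real.exp 1), ← mul_div_assoc, ← mul_div_assoc,
        div_le_div_iff₀ (by positivity) (by positivity)]
      have := mul_le_mul_of_nonneg_left h1 (by positivity : 0 ≤ Real.exp 1 * Real.exp 1 ^ k)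
      rw [pow_succ] at this
      linarith
    nlinarith [mul_le_mul_of_nonneg_left h4 (by positivity : (0 : ℝ) ≤ k + 1)]

theorem pow_add_le_add_pow {s t : ℕ} (hs : 1 ≤ s) (e : ℕ) : s ^ (e + 1) + t ≤ (s + t) ^ (e + 1) := by
  rw [pow_succ (s + t), mul_add, pow_succ]
  have h1 : s ^ e ≤ (s + t) ^ e := Nat.pow_le_pow_left (by omega) e
  have h2 : 1 ≤ (s + t) ^ e := Nat.one_le_pow _ _ (by omega)
  nlinarith [Nat.mul_le_mul_right s h1, Nat.mul_le_mul_right t h2]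

/-- For `k = s + t`, `s ^ (d-1) ≤ k ^ (d-1) - t`. The first factor will cancel against the `s`-th
power of `asymptoticOrder`; the second is the gain. -/
theorem rpow_pow_div_le {d q s t : ℕ} (hd : 2 ≤ d) (hq : 0 < q) (hs : 1 ≤ s) :
    (q : ℝ) ^ ((s : ℝ) ^ d / d) ≤ ((q : ℝ) ^ (((s + t : ℕ) : ℝ) ^ (d - 1) / (d : ℝ))) ^ s *
      ((q : ℝ) ^ (-(1 / (d : ℝ)))) ^ (s * t) := by
  have hq0 : (0 : ℝ) < q := by exact_mod_cast hq
  have hq1 : (1 : ℝ) ≤ q := by exact_mod_cast hq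
  have hd0 : (0 : ℝ) < d := by exact_mod_cast (by omega : 0 < d)
  rw [← Real.rpow_mul_natCast hq0.le, ← Real.rpow_mul_natCast hq0.le, ← Real.rpow_add hq0]
  refine Real.rpow_le_rpow_of_exponent_le hq1 ?_
  obtain ⟨e, rfl⟩ := Nat.exists_eq_add_of_le' hd
  have h : ((s : ℝ) ^ (e + 1) + t) * s ≤ ((s + t : ℕ) : ℝ) ^ (e + 1) * s :=
    mul_le_mul_of_nonneg_right (by exact_mod_cast pow_add_le_add_pow hs e) (by positivity)
  have e1 : ((s + t : ℕ) : ℝ) ^ (e + 2 - 1) / ((e + 2 : ℕ) : ℝ) * s +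
      -(1 / ((e + 2 : ℕ) : ℝ)) * ((s * t : ℕ) : ℝ) =
      (((s + t : ℕ) : ℝ) ^ (e + 1) * s - s * t) / ((e + 2 : ℕ) : ℝ) := by
    rw [show e + 2 - 1 = e + 1 by omega]
    push_cast
    ring
  rw [e1]
  refine div_le_div_of_nonneg_right ?_ hd0.le
  rw [pow_succ]
  linarith

theorem pow_le_factorial_mul_choose {n k s : ℕ} {N : ℝ} (hN : 0 ≤ N) (hn : N + k ≤ n)
    (hs : s ≤ k) : N ^ s ≤ s.factorial * n.choose s := by
  have h1 : (n + 1 - s) ^ s ≤ s.factorial * n.choose s := by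
    rw [← Nat.descFactorial_eq_factorial_mul_choose]
    exact Nat.pow_sub_le_descFactorial n s
  have hkn : k ≤ n := by
    have : (k : ℝ) ≤ n := by linarith
    exact_mod_cast this
  have h2 : N ≤ ((n + 1 - s : ℕ) : ℝ) := by
    rw [Nat.cast_sub (by omega)]
    have : (s : ℝ) ≤ k := by exact_mod_cast hs
    push_cast
    linarith
  exact (pow_le_pow_left₀ hN h2 s).trans (by exact_mod_cast h1)

/-- The bound for the terms of `overlapSum` before choosing how to bound the numerator. -/
theorem overlap_term_le {d q n s t : ℕ} {a X : ℝ} (hd : 2 ≤ d) (hq : 0 < q) (ha : 0 < a)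
    (hs : 1 ≤ s) (hn : a * asymptoticOrder d q (s + t) + ((s + t : ℕ) : ℝ) ≤ n)
    (hX : ((s + t).choose s : ℝ) * (s.factorial * (s + t).choose s) ≤ X) :
    ((s + t).choose s : ℝ) ^ 2 / n.choose s * (q : ℝ) ^ ((s : ℝ) ^ d / d) ≤
      X * (Real.exp 1 / (s + t : ℕ)) ^ s * (1 / a) ^ s *
        ((q : ℝ) ^ (-(1 / (d : ℝ)))) ^ (s * t) := by
  have hq0 : (0 : ℝ) < q := by exact_mod_cast hq
  have hk0 : (0 : ℝ) < (s + t : ℕ) := by exact_mod_cast (by omega : 0 < s + t)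
  have he := Real.exp_pos 1
  have hN : 0 < a * asymptoticOrder d q (s + t) :=
    mul_pos ha (asymptoticOrder_pos hq (by omega))
  have h1 := pow_le_factorial_mul_choose hN.le hn (Nat.le_add_right s t)
  have hf : (0 : ℝ) < s.factorial := by exact_mod_cast s.factorial_pos
  have hX0 : 0 ≤ X := le_trans (by positivity) hX
  have hC : 0 < (n.choose s : ℝ) := by
    have : 0 < (s.factorial : ℝ) * n.choose s := (pow_pos hN s).trans_le h1
    exact pos_of_mul_pos_right this hf.le
  have h2 : ((s + t).choose s : ℝ) ^ 2 / n.choose s ≤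
      X / (a * asymptoticOrder d q (s + t)) ^ s := by
    have e : ((s + t).choose s : ℝ) ^ 2 / n.choose s =
        ((s + t).choose s * (s.factorial * (s + t).choose s)) / (s.factorial * n.choose s) := by
      field_simp
    rw [e]
    exact div_le_div₀ hX0 hX (pow_pos hN s) h1
  refine (mul_le_mul h2 (rpow_pow_div_le hd hq hs (t := t)) (by positivity)
    (by positivity)).trans (le_of_eq ?_)
  unfold asymptoticOrder
  set Q : ℝ := (q : ℝ) ^ (((s + t : ℕ) : ℝ) ^ (d - 1) / (d : ℝ))
  have hQ : 0 < Q := by positivity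
  rw [← mul_assoc]
  congr 1
  rw [div_mul_eq_mul_div, div_eq_iff (by positivity), mul_assoc X, ← mul_pow, mul_assoc X,
    ← mul_pow]
  congr 2
  field_simp

/-- Small overlaps: the numerator is at most `k ^ (2s)`, and since `2t ≥ k` the gain `c ^ (2st)` is
at most `(c ^ k) ^ s`. -/
theorem overlap_term_le_of_two_mul_le {d q n s t : ℕ} {a c : ℝ} (hd : 2 ≤ d) (hq : 0 < q)
    (ha : 1 ≤ a) (hs : 1 ≤ s) (hst : s ≤ t)
    (hn : a * asymptoticOrder d q (s + t) + ((s + t : ℕ) : ℝ) ≤ n)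
    (hc0 : 0 ≤ c) (hc1 : c ≤ 1) (hc : c ^ 2 = (q : ℝ) ^ (-(1 / (d : ℝ))))
    (hsmall : Real.exp 1 * (s + t : ℕ) * c ^ (s + t) ≤ 1) :
    ((s + t).choose s : ℝ) ^ 2 / n.choose s * (q : ℝ) ^ ((s : ℝ) ^ d / d) ≤
      Real.exp 1 * (s + t : ℕ) * c ^ (s + t) := by
  have ha0 : 0 < a := by linarith
  have he := Real.exp_pos 1
  have hk0 : (0 : ℝ) < (s + t : ℕ) := by exact_mod_cast (by omega : 0 < s + t)
  set k : ℝ := ((s + t : ℕ) : ℝ)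
  have hX : ((s + t).choose s : ℝ) * (s.factorial * (s + t).choose s) ≤ k ^ s * k ^ s := by
    refine mul_le_mul ((Nat.cast_le.2 (Nat.choose_le_pow (s + t) s)).trans
      (Nat.cast_pow _ _).le) ?_ (by positivity)
      (by positivity)
    have := Nat.descFactorial_le_pow (s + t) s
    rw [Nat.descFactorial_eq_factorial_mul_choose] at this
    rw [← Nat.cast_mul]
    exact (Nat.cast_le.2 this).trans (Nat.cast_pow _ _).le
  refine (overlap_term_le hd hq ha0 hs hn hX).trans ?_
  rw [← hc]
  have h1 : (1 / a) ^ s ≤ 1 := pow_le_one₀ (by positivity) (by rw [div_le_one ha0]; exact ha)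
  have h2 : (c ^ 2) ^ (s * t) ≤ (c ^ (s + t)) ^ s := by
    rw [← pow_mul, ← pow_mul]
    exact pow_le_pow_of_le_one hc0 hc1 (by nlinarith)
  have h3 : k ^ s * k ^ s * (Real.exp 1 / k) ^ s = (Real.exp 1 * k) ^ s := by
    rw [← mul_pow, ← mul_pow]
    congr 1
    field_simp
  rw [h3]
  calc (Real.exp 1 * k) ^ s * (1 / a) ^ s * (c ^ 2) ^ (s * t) ≤
        (Real.exp 1 * k) ^ s * 1 * (c ^ (s + t)) ^ s := by gcongr
    _ = (Real.exp 1 * k * c ^ (s + t)) ^ s := by rw [mul_one, ← mul_pow]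
    _ ≤ Real.exp 1 * k * c ^ (s + t) := pow_le_of_le_one (by positivity) hsmall (by omega)

/-- Large overlaps: the numerator is at most `k ^ t * k!`. Stirling cancels `(e / k) ^ s`, the gain
in `c` absorbs `k ^ (2t)`, and `a ^ (-s) ≤ b ^ k` since `2s ≥ k`. -/
theorem overlap_term_le_of_le {d q n s t : ℕ} {a b c : ℝ} (hd : 2 ≤ d) (hq : 0 < q)
    (ha : 1 ≤ a) (hs : 1 ≤ s) (hst : t ≤ s)
    (hn : a * asymptoticOrder d q (s + t) + ((s + t : ℕ) : ℝ) ≤ n)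
    (hb0 : 0 ≤ b) (hb1 : b ≤ 1) (hb : b ^ 2 = 1 / a)
    (hc0 : 0 ≤ c) (hc1 : c ≤ 1) (hc : c ^ 2 = (q : ℝ) ^ (-(1 / (d : ℝ))))
    (hsmall : ((s + t : ℕ) : ℝ) ^ 2 * c ^ (s + t) ≤ 1) :
    ((s + t).choose s : ℝ) ^ 2 / n.choose s * (q : ℝ) ^ ((s : ℝ) ^ d / d) ≤
      Real.exp 1 * (s + t : ℕ) * b ^ (s + t) := by
  have ha0 : 0 < a := by linarith
  have he := Real.exp_pos 1
  have he1 : 1 ≤ Real.exp 1 := Real.one_le_exp zero_le_one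
  have hk0 : (0 : ℝ) < (s + t : ℕ) := by exact_mod_cast (by omega : 0 < s + t)
  have hfac := factorial_le_exp_mul_pow (k := s + t) (by omega)
  set k : ℝ := ((s + t : ℕ) : ℝ)
  have hX : ((s + t).choose s : ℝ) * (s.factorial * (s + t).choose s) ≤
      k ^ t * (Real.exp 1 * k * (k / Real.exp 1) ^ (s + t)) := by
    refine mul_le_mul ?_ (le_trans ?_ hfac) (by positivity) (by positivity)
    · rw [Nat.choose_symm_add]
      exact (Nat.cast_le.2 (Nat.choose_le_pow (s + t) t)).trans (Nat.cast_pow _ _).le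
    · have := Nat.add_choose_mul_factorial_mul_factorial s t
      have h1 : s.factorial * (s + t).choose s ≤ (s + t).factorial := by
        rw [← this, Nat.choose_symm_add, mul_comm s.factorial]
        exact Nat.le_mul_of_pos_right _ t.factorial_pos
      exact_mod_cast h1
  refine (overlap_term_le hd hq ha0 hs hn hX).trans ?_
  rw [← hc, ← hb]
  have h1 : (b ^ 2) ^ s ≤ b ^ (s + t) := by
    rw [← pow_mul]
    exact pow_le_pow_of_le_one hb0 hb1 (by omega)
  have h2 : (c ^ 2) ^ (s * t) ≤ (c ^ (s + t)) ^ t := by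
    rw [← pow_mul, ← pow_mul]
    exact pow_le_pow_of_le_one hc0 hc1 (by nlinarith)
  have h3 : k ^ t * (Real.exp 1 * k * (k / Real.exp 1) ^ (s + t)) * (Real.exp 1 / k) ^ s =
      Real.exp 1 * k * (k ^ 2 / Real.exp 1) ^ t := by
    have e1 : (k / Real.exp 1) ^ s * (Real.exp 1 / k) ^ s = 1 := by
      rw [← mul_pow, div_mul_div_cancel₀ he.ne', div_self hk0.ne', one_pow]
    have e2 : (k ^ 2 / Real.exp 1) ^ t = k ^ t * (k / Real.exp 1) ^ t := by
      rw [← mul_pow]; congr 1; ring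
    rw [e2, pow_add]
    linear_combination (k ^ t * Real.exp 1 * k * (k / Real.exp 1) ^ t) * e1
  have h4 : (k ^ 2 / Real.exp 1) ^ t ≤ (k ^ 2) ^ t :=
    pow_le_pow_left₀ (by positivity) (div_le_self (by positivity) he1) t
  rw [h3]
  calc Real.exp 1 * k * (k ^ 2 / Real.exp 1) ^ t * (b ^ 2) ^ s * (c ^ 2) ^ (s * t) ≤
        Real.exp 1 * k * (k ^ 2) ^ t * b ^ (s + t) * (c ^ (s + t)) ^ t := by gcongr
    _ = Real.exp 1 * k * b ^ (s + t) * (k ^ 2 * c ^ (s + t)) ^ t := by rw [mul_pow]; ring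
    _ ≤ Real.exp 1 * k * b ^ (s + t) :=
      mul_le_of_le_one_right (by positivity) (pow_le_one₀ (by positivity) hsmall)

theorem overlapSum_le {d q n k : ℕ} {a b c : ℝ} (hd : 2 ≤ d) (hq : 0 < q) (ha : 1 ≤ a)
    (hn : a * asymptoticOrder d q k + k ≤ n) (hb0 : 0 ≤ b) (hb1 : b ≤ 1) (hb : b ^ 2 = 1 / a)
    (hc0 : 0 ≤ c) (hc1 : c ≤ 1) (hc : c ^ 2 = (q : ℝ) ^ (-(1 / (d : ℝ))))
    (hsmall : Real.exp 1 * k * c ^ k ≤ 1) (hsmall' : (k : ℝ) ^ 2 * c ^ k ≤ 1) :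
    overlapSum d q n k ≤ k * (Real.exp 1 * k * (b ^ k + c ^ k)) := by
  have he := Real.exp_pos 1
  have hterm : ∀ s ∈ Finset.Icc 1 k,
      (k.choose s : ℝ) ^ 2 / n.choose s * (q : ℝ) ^ ((s : ℝ) ^ d / d) ≤
        Real.exp 1 * k * (b ^ k + c ^ k) := by
    intro s hs
    obtain ⟨hs1, hsk⟩ := Finset.mem_Icc.1 hs
    obtain ⟨t, rfl⟩ := Nat.exists_eq_add_of_le hsk
    have hB : 0 ≤ Real.exp 1 * ((s + t : ℕ) : ℝ) * b ^ (s + t) := by positivity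
    have hC : 0 ≤ Real.exp 1 * ((s + t : ℕ) : ℝ) * c ^ (s + t) := by positivity
    rw [mul_add]
    rcases le_total s t with h | h
    · linarith [overlap_term_le_of_two_mul_le hd hq ha hs1 h hn hc0 hc1 hc hsmall]
    · linarith [overlap_term_le_of_le hd hq ha hs1 h hn hb0 hb1 hb hc0 hc1 hc hsmall']
  refine (Finset.sum_le_sum hterm).trans (le_of_eq ?_)
  simp

theorem eventually_mem_universalOrders {d q : ℕ} (hd : 2 ≤ d) (hq : 2 ≤ q) {a : ℝ} (ha : 1 < a) :
    ∀ᶠ k : ℕ in atTop, ∀ n : ℕ, a * asymptoticOrder d q k + k ≤ n →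
      n ∈ DArray.universalOrders d q k := by
  have hq0 : (0 : ℝ) < q := by exact_mod_cast (by omega : 0 < q)
  have hq1 : (1 : ℝ) < q := by exact_mod_cast (by omega : 1 < q)
  have hd0 : (0 : ℝ) < d := by exact_mod_cast (by omega : 0 < d)
  have ha0 : 0 < a := by linarith
  -- Square roots, because only `2s ≥ k` or `2t ≥ k` is available.
  set b := √(1 / a) with hb
  set c := √((q : ℝ) ^ (-(1 / (d : ℝ)))) with hc
  have hb0 : 0 ≤ b := Real.sqrt_nonneg _
  have hc0 : 0 ≤ c := Real.sqrt_nonneg _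
  have hb1 : b < 1 := by
    rw [hb, Real.sqrt_lt' one_pos, one_pow, div_lt_one ha0]; exact ha
  have hc1 : c < 1 := by
    rw [hc, Real.sqrt_lt' one_pos, one_pow]
    exact Real.rpow_lt_one_of_one_lt_of_neg hq1 (by simpa using hd0)
  have hb2 : b ^ 2 = 1 / a := Real.sq_sqrt (by positivity)
  have hc2 : c ^ 2 = (q : ℝ) ^ (-(1 / (d : ℝ))) := Real.sq_sqrt (by positivity)
  have hbabs : |b| < 1 := by rwa [abs_of_nonneg hb0]
  have hcabs : |c| < 1 := by rwa [abs_of_nonneg hc0]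
  have t1 : Tendsto (fun k : ℕ => Real.exp 1 * ((k : ℝ) ^ 1 * c ^ k)) atTop (nhds 0) := by
    simpa using (tendsto_pow_const_mul_const_pow_of_abs_lt_one 1 hcabs).const_mul (Real.exp 1)
  have t2 := tendsto_pow_const_mul_const_pow_of_abs_lt_one 2 hcabs
  have t3 : Tendsto (fun k : ℕ => 2 * Real.log q *
      (Real.exp 1 * ((k : ℝ) ^ 3 * b ^ k + (k : ℝ) ^ 3 * c ^ k)) ^ d) atTop (nhds 0) := by
    have h := ((((tendsto_pow_const_mul_const_pow_of_abs_lt_one 3 hbabs).add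
      (tendsto_pow_const_mul_const_pow_of_abs_lt_one 3 hcabs)).const_mul (Real.exp 1)).pow
      d).const_mul (2 * Real.log q)
    simpa [zero_pow (by omega : d ≠ 0)] using h
  filter_upwards [t1.eventually_le_const one_pos, t2.eventually_le_const one_pos,
    t3.eventually_lt_const one_pos, eventually_ge_atTop 1] with k h1 h2 h3 hk n hn
  have hk0 : (0 : ℝ) < k := by exact_mod_cast hk
  have hT := asymptoticOrder_pos (d := d) (by omega : 0 < q) hk
  have hkn : k ≤ n := by
    have : (k : ℝ) ≤ n := by nlinarith
    exact_mod_cast this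
  refine mem_universalOrders_of_overlapSum (by omega) (by omega) hk hkn (lt_of_le_of_lt ?_ h3)
  have hG := overlapSum_le hd (by omega) ha.le hn hb0 hb1.le hb2 hc0 hc1.le hc2
    (by rw [pow_one, ← mul_assoc] at h1; exact h1) h2
  have hG0 := overlapSum_pos (d := d) (by omega : 0 < q) hk hkn
  have hlog : 0 ≤ Real.log q := Real.log_nonneg hq1.le
  calc 2 * ((k : ℝ) ^ d * Real.log q) * overlapSum d q n k ^ d
      = 2 * Real.log q * (k * overlapSum d q n k) ^ d := by rw [mul_pow]; ring
    _ ≤ 2 * Real.log q * (k * (k * (Real.exp 1 * k * (b ^ k + c ^ k)))) ^ d := by gcongr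
    _ = _ := by congr 2; ring

/-! ### Conclusion -/

theorem eventually_minUniversalOrder_le {d q : ℕ} (hd : 2 ≤ d) (hq : 2 ≤ q) {ε : ℝ} (hε : 0 < ε) :
    ∀ᶠ k : ℕ in atTop,
      (DArray.minUniversalOrder d q k : ℝ) ≤ (1 + ε) * asymptoticOrder d q k := by
  have hq1 : (1 : ℝ) < q := by exact_mod_cast (by omega : 1 < q)
  have hd0 : (0 : ℝ) < d := by exact_mod_cast (by omega : 0 < d)
  have he := Real.exp_pos 1
  have hroot : 1 < (q : ℝ) ^ (1 / (d : ℝ)) := Real.one_lt_rpow hq1 (by positivity)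
  filter_upwards [eventually_mem_universalOrders hd hq (a := 1 + ε / 2) (by linarith),
    (tendsto_pow_atTop_atTop_of_one_lt hroot).eventually_ge_atTop (4 * Real.exp 1 / ε),
    eventually_ge_atTop 1] with k h1 h2 hk
  have hk1 : (1 : ℝ) ≤ k := by exact_mod_cast hk
  have hT := asymptoticOrder_pos (d := d) (by omega : 0 < q) hk
  -- Rounding and the summand `k` cost at most `k + 1 ≤ 2k`, absorbed by the other `ε / 2` since
  -- `asymptoticOrder / k` grows exponentially or faster.
  set n := ⌈(1 + ε / 2) * asymptoticOrder d q k⌉₊ + k with hn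
  have hmem := h1 n (by
    rw [hn]
    push_cast
    linarith [Nat.le_ceil ((1 + ε / 2) * asymptoticOrder d q k)])
  have hle : (DArray.minUniversalOrder d q k : ℝ) ≤ n := by exact_mod_cast Nat.sInf_le hmem
  have hceil := Nat.ceil_lt_add_one
    (by positivity : 0 ≤ (1 + ε / 2) * asymptoticOrder d q k)
  have hQ : ((q : ℝ) ^ (1 / (d : ℝ))) ^ k ≤ (q : ℝ) ^ ((k : ℝ) ^ (d - 1) / (d : ℝ)) := by
    rw [← Real.rpow_natCast, ← Real.rpow_mul (by linarith)]
    refine Real.rpow_le_rpow_of_exponent_le hq1.le ?_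
    rw [one_div_mul_eq_div]
    exact div_le_div_of_nonneg_right (le_self_pow₀ hk1 (by omega)) hd0.le
  have hbig : 2 * (k : ℝ) ≤ ε / 2 * asymptoticOrder d q k := by
    have h3 := h2.trans hQ
    rw [div_le_iff₀ hε] at h3
    unfold asymptoticOrder
    set Q := (q : ℝ) ^ ((k : ℝ) ^ (d - 1) / (d : ℝ))
    rw [show ε / 2 * ((k : ℝ) / Real.exp 1 * Q) = ε * k * Q / (2 * Real.exp 1) by field_simp,
      le_div_iff₀ (by positivity)]
    nlinarith
  rw [hn] at hle
  push_cast at hle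
  linarith

/-- The probabilistic bound holds only for large orders; a small `k` inherits a universal array from
a larger `l`. -/
theorem universalOrders_nonempty {d q : ℕ} (hd : 2 ≤ d) (hq : 2 ≤ q) (k : ℕ) :
    (DArray.universalOrders d q k).Nonempty := by
  obtain ⟨l, hl, hkl⟩ := ((eventually_mem_universalOrders hd hq one_lt_two).and
    (eventually_ge_atTop k)).exists
  exact ⟨_, DArray.universalOrders_anti d q hkl
    (hl ⌈2 * asymptoticOrder d q l + l⌉₊ (Nat.le_ceil _))⟩

theorem corollary4 (d q : ℕ) (hd : 2 ≤ d) (hq : 2 ≤ q) :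
    (∀ k : ℕ, 1 ≤ k →
      IsLeast (DArray.universalOrders d q k) (DArray.minUniversalOrder d q k)) ∧
    Asymptotics.IsEquivalent atTop
      (fun k : ℕ => (DArray.minUniversalOrder d q k : ℝ))
      (fun k : ℕ => (k : ℝ) / Real.exp 1 * (q : ℝ) ^ ((k : ℝ) ^ (d - 1) / (d : ℝ))) := by
  have hmem : ∀ k, DArray.minUniversalOrder d q k ∈ DArray.universalOrders d q k := fun k =>
    Nat.sInf_mem (universalOrders_nonempty hd hq k)
  refine ⟨fun k _ => ⟨hmem k, fun n hn => Nat.sInf_le hn⟩, ?_⟩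
  refine Asymptotics.isLittleO_iff.2 fun ε hε => ?_
  filter_upwards [eventually_minUniversalOrder_le hd hq hε, eventually_ge_atTop 1] with k hk hk1
  have hlow := asymptoticOrder_le_of_mem (by omega) (by omega) hk1 (hmem k)
  have hT := asymptoticOrder_pos (d := d) (by omega : 0 < q) hk1
  change ‖(DArray.minUniversalOrder d q k : ℝ) - asymptoticOrder d q k‖ ≤
    ε * ‖asymptoticOrder d q k‖
  rw [Real.norm_of_nonneg (sub_nonneg.2 hlow), Real.norm_of_nonneg hT.le]
  linarith
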